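/- **Uniform Diagonalization Theorem (for promise problems).** *Definitions.* Let $\Sigma=\{0,1\}$. A promise problem is a pair $A=(A_{\rm yes},A_{\rm no})$ of disjoint subsets of $\Sigma^*$; it is a decision problem if $A_{\rm yes}\cup A_{\rm no}=\Sigma^*$, and a subproblem of $B$ if $A_{\rm yes}\subseteq B_{\rm yes}$ and $A_{\rm no}\subseteq B_{\rm no}$. A complexity class is any set of promise problems. Put $A\setminus B:=(A_{\rm yes}\setminus B_{\rm yes})\cup(A_{\rm no}\setminus B_{\rm no})$; $A$ equals $B$ almost everywhere if $(A\setminus B)\cup(B\setminus A)$ is finite. A class $C$ is closed under finite variations if $A\in C$ implies $B\in C$ for every $B$ that equals $A$ almost everywhere; if $C$ consists of decision problems only, it suffices that this holds for all decision problems $B$. A program $M$ totally decides $A$ if $M(x)=1$ for $x\in A_{\rm yes}$, $M(x)=0$ for $x\in A_{\rm no}$ and $M(x)=10$ for $x\notin A_{\rm yes}\cup A_{\rm no}$; $A$ is totally decidable if some program totally decides it. A class $C$ is recursively presentable if there is a computable series $M_0,M_1,\dots$ of programs that halt on all inputs such that $C$ contains exactly those promise problems that are totally decided by some $M_i$. A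 class is recursively representable if it is the closure of a recursively presentable class under passing to subproblems. $A\le_m^P B$ means that there is a function $f:\Sigma^*\to\Sigma^*$, computable by a deterministic Turing machine in polynomial time, with $f(A_{\rm yes})\subseteq B_{\rm yes}$ and $f(A_{\rm no})\subseteq B_{\rm no}$. The marked union $A\oplus A'$ has yes-instances $\{0x: x\in A_{\rm yes}\}\cup\{1x: x\in A'_{\rm yes}\}$ and no-instances $\{0x: x\in A_{\rm no}\}\cup\{1x: x\in A'_{\rm no}\}$. Let $\mathcal C=\{\mathrm{PromiseBPP},\mathrm{PromiseMA},\mathrm{BQP},\mathrm{QCMA},\mathrm{QMA}\}$. A machine $M$ of one of these classes has, on a problem input $x$ and a witness $w$, an acceptance probability $P_{\rm acc}(x,w)$. The machines are the following. - $\mathrm{PromiseBPP}$ (no witness) and $\mathrm{PromiseMA}$ (witness $w\in\Sigma^{m(|x|)}$): probabilistic Turing machines all of whose branches halt in polynomial time on every input. The transition function yields a finite set of possible actions, and $P_{\rm acc}$ is the number of branches with output $1$ divided by the number of all branches. - $\mathrm{BQP}$ (no witness), $\mathrm{QCMA}$ (witness a computational basis state of $m(|x|)$ qubits) and $\mathrm{QMA}$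 (witness a unit vector in $\mathbb C^{2^{m(|x|)}}$): polynomial-time deterministic Turing machines that output on $x$ the code of a quantum circuit over the gates Hadamard, $T=\mathrm{diag}(1,e^{i\pi/4})$ and CNOT, acting on the witness and on ancilla qubits in the state $0$. $P_{\rm acc}$ is the probability to measure $1$ on the first qubit. An output that is not the code of a circuit stands for a circuit that never accepts. For $\mathrm{QCMA}$ and $\mathrm{QMA}$ the numbers of witness qubits $m(|x|)$ and of ancilla qubits $k(|x|)$ depend only on $|x|$, and $k+m$ is in poly. Here the witness length $m$ is in poly, where poly is the set of polynomially bounded functions $f:\mathbb N_0\to\mathbb N_0$ for which the binary representation of $f(|x|)$ is computable from $x$ in polynomial time. The machine $M$ decides $A$ if every $x\in A_{\rm yes}$ has a witness $w$ with $P_{\rm acc}(x,w)\ge\frac23$ and every $x\in A_{\rm no}$ satisfies $P_{\rm acc}(x,w)\le\frac13$ for all witnesses $w$. The extremal problem of $M$ is the problem with the largest promise decided by $M$, i.e. the problem decided by $M$ of which every problem decided by $M$ is a subproblem. A problem is extremal for $D\in\mathcal C$ if it is the extremal problem of some machine of $D$. **Theorem.** Let $C,C'$ be complexity classes closed under finite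 variations, each of which is recursively presentable or recursively representable. Let $A\notin C$ and $A'\notin C'$ be totally decidable promise problems. Then there exists a totally decidable promise problem $B$ such that $$B\notin C\cup C'\quad\text{and}\quad B\le_m^P A\oplus A'.$$ Moreover, $B$ can be chosen such that for every $D\in\mathcal C$ for which both $A$ and $A'$ are extremal, $B$ is extremal for $D$ as well; and such that $B$ is a decision problem if both $A$ and $A'$ are decision problems. -/

import Mathlib

/-! ## Promise problems -/

namespace UDT

/-- Strings over the binary alphabet; `false` is the symbol `0` and `true` is the symbol `1`. -/
abbrev Str := List Bool

/-- A promise problem: two disjoint sets of strings. -/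
@[ext]
structure PromiseProblem where
  yes : Set Str
  no : Set Str
  disj : yes ∩ no = ∅

namespace PromiseProblem

/-- The promise of a problem. -/
def promise (A : PromiseProblem) : Set Str := A.yes ∪ A.no

/-- Decision problems: every string is promised. -/
def IsDecision (A : PromiseProblem) : Prop := A.promise = Set.univ

/-- `A` is a subproblem (promise restriction) of `B`. -/
def IsSubproblem (A B : PromiseProblem) : Prop := A.yes ⊆ B.yes ∧ A.no ⊆ B.no

/-- The difference `A \ B`, a set of strings. -/
def diff (A B : PromiseProblem) : Set Str := (A.yes \ B.yes) ∪ (A.no \ B.no)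

/-- The total symmetric difference. -/
def totalSymmDiff (A B : PromiseProblem) : Set Str := A.diff B ∪ B.diff A

/-- `A` equals `B` almost everywhere. -/
def AlmostEq (A B : PromiseProblem) : Prop := (A.totalSymmDiff B).Finite

/-- The marked union `A ⊕ B`. -/
def markedUnion (A B : PromiseProblem) : PromiseProblem where
  yes := (List.cons false '' A.yes) ∪ (List.cons true '' B.yes)
  no := (List.cons false '' A.no) ∪ (List.cons true '' B.no)
  disj := by
    ext w
    simp only [Set.mem_inter_iff, Set.mem_union, Set.mem_image, Set.mem_empty_iff_false,
      iff_false, not_and]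
    rintro (⟨x, hx, rfl⟩ | ⟨x, hx, rfl⟩) (⟨y, hy, h⟩ | ⟨y, hy, h⟩)
    · obtain rfl : y = x := by simpa using h
      exact (Set.ext_iff.1 A.disj y).1 ⟨hx, hy⟩
    · simp at h
    · simp at h
    · obtain rfl : y = x := by simpa using h
      exact (Set.ext_iff.1 B.disj y).1 ⟨hx, hy⟩

end PromiseProblem

/-- A complexity class is any set of promise problems. -/
abbrev ComplexityClass := Set PromiseProblem

/-- Closure under finite variations.  For a class that consists of decision problems, only those
variations are considered which are decision problems themselves. -/
def ClosedUnderFiniteVariations (C : ComplexityClass) : Prop :=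
  (∀ A ∈ C, ∀ B : PromiseProblem, A.AlmostEq B → B ∈ C) ∨
    ((∀ A ∈ C, A.IsDecision) ∧
      ∀ A ∈ C, ∀ B : PromiseProblem, B.IsDecision → A.AlmostEq B → B ∈ C)

/-! ## Computability: total decidability and recursive (re)presentation

Programs are the codes of partial recursive functions; `Nat.Partrec.Code` with its encoding by
natural numbers is the Gödel numbering. -/

/-- The program `c`, started on the string `x`, halts. -/
def HaltsOn (c : Nat.Partrec.Code) (x : Str) : Prop := (c.eval (Encodable.encode x)).Dom

/-- The program `c`, started on the string `x`, halts and outputs the string `w`. -/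
def Returns (c : Nat.Partrec.Code) (x w : Str) : Prop :=
  Encodable.encode w ∈ c.eval (Encodable.encode x)

/-- `c` answers `1` on yes-instances, `0` on no-instances and `10` on all other strings. -/
def TotallyDecides (c : Nat.Partrec.Code) (A : PromiseProblem) : Prop :=
  (∀ x ∈ A.yes, Returns c x [true]) ∧
  (∀ x ∈ A.no, Returns c x [false]) ∧
  (∀ x, x ∉ A.promise → Returns c x [true, false])

def TotallyDecidable (A : PromiseProblem) : Prop :=
  ∃ c : Nat.Partrec.Code, TotallyDecides c A

/-- There is a computable series of halting programs such that `C` contains exactly the problems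
that are totally decided by some member of the series. -/
def RecursivelyPresentable (C : ComplexityClass) : Prop :=
  ∃ M : ℕ → Nat.Partrec.Code, Computable M ∧ (∀ i x, HaltsOn (M i) x) ∧
    ∀ A : PromiseProblem, A ∈ C ↔ ∃ i, TotallyDecides (M i) A

/-- The closure of a class under promise restriction. -/
def restrictionClosure (C : ComplexityClass) : ComplexityClass :=
  {A | ∃ B ∈ C, A.IsSubproblem B}

def RecursivelyRepresentable (C : ComplexityClass) : Prop :=
  ∃ C₀ : ComplexityClass, RecursivelyPresentable C₀ ∧ C = restrictionClosure C₀

/-! ## Turing machines with step count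

Machines have finitely many two-way infinite tapes (indexed by `ι`) over the alphabet
`{0, 1, blank}`, represented as `Option Bool` with `none` the blank.  One tape, `io`, carries the
input at the start and the output at the end; the other tapes are blank at the start. -/

/-- A configuration. -/
structure Cfg (S ι : Type) where
  state : S
  tapes : ι → Turing.Tape (Option Bool)

/-- What a machine does in one step: the new state, and for each tape the symbol to be written
and the head movement, where `none` means that the head does not move. -/
abbrev Action (S ι : Type) := S × (ι → Option Bool × Option Turing.Dir)

/-- Move the head, or leave it where it is. -/
def moveHead (T : Turing.Tape (Option Bool)) : Option Turing.Dir → Turing.Tape (Option Bool)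
  | none => T
  | some d => T.move d

namespace Cfg

variable {S ι : Type}

/-- The symbols under the heads. -/
def read (c : Cfg S ι) : ι → Option Bool := fun i => (c.tapes i).head

/-- Perform an action. -/
def apply (c : Cfg S ι) (a : Action S ι) : Cfg S ι where
  state := a.1
  tapes := fun i => moveHead ((c.tapes i).write (a.2 i).1) (a.2 i).2

end Cfg

/-- The string on the tape between the head position and the next blank is `w`. -/
def TapeShows (T : Turing.Tape (Option Bool)) (w : Str) : Prop :=
  ∀ i : ℕ, i ≤ w.length → T.nth (i : ℤ) = w[i]?

/-- The tape that holds the string `x`, with the head on its first symbol. -/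
def inputTape (x : Str) : Turing.Tape (Option Bool) := Turing.Tape.mk₁ (x.map some)

/-- The tape that holds the strings `x` and `y` separated by a blank. -/
def inputTape₂ (x y : Str) : Turing.Tape (Option Bool) :=
  Turing.Tape.mk₁ (x.map some ++ none :: y.map some)

/-- Deterministic Turing machines. -/
structure DTM where
  State : Type
  ι : Type
  finState : Finite State
  finTapes : Finite ι
  io : ι
  start : State
  final : Set State
  δ : State → (ι → Option Bool) → Action State ι

namespace DTM

open Classical in
/-- The initial configuration with tape `T` as input. -/
noncomputable def init (M : DTM) (T : Turing.Tape (Option Bool)) : Cfg M.State M.ι where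
  state := M.start
  tapes := fun i => if i = M.io then T else Turing.Tape.mk₁ []

open Classical in
/-- One computational step; nothing changes any more once a final state is reached. -/
noncomputable def step (M : DTM) (c : Cfg M.State M.ι) : Cfg M.State M.ι :=
  if c.state ∈ M.final then c else c.apply (M.δ c.state c.read)

/-- On input `x` the machine halts in at most `t` steps, with output `w`. -/
def OutputsWithin (M : DTM) (x : Str) (t : ℕ) (w : Str) : Prop :=
  (M.step^[t] (M.init (inputTape x))).state ∈ M.final ∧
    TapeShows ((M.step^[t] (M.init (inputTape x))).tapes M.io) w

end DTM

/-- Functions computed by a deterministic Turing machine of polynomial runtime. -/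
def PolyTimeComputable (f : Str → Str) : Prop :=
  ∃ (M : DTM) (p : Polynomial ℕ), ∀ x : Str, M.OutputsWithin x (p.eval x.length) (f x)

/-- Karp reducibility `A ≤ₘᴾ B`. -/
def KarpReducible (A B : PromiseProblem) : Prop :=
  ∃ f : Str → Str, PolyTimeComputable f ∧
    (∀ x ∈ A.yes, f x ∈ B.yes) ∧ (∀ x ∈ A.no, f x ∈ B.no)

/-- Binary representation without leading zeros, most significant bit first. -/
def bin (n : ℕ) : Str := if n = 0 then [false] else n.bits.reverse

/-- The set `poly`: polynomially bounded functions `f` such that a deterministic Turing machine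
outputs `bin (f n)` in polynomial time on all inputs of length `n`. -/
def IsPoly (f : ℕ → ℕ) : Prop :=
  (∃ p : Polynomial ℕ, ∀ n, f n ≤ p.eval n) ∧
    PolyTimeComputable (fun x => bin (f x.length))

/-- Probabilistic Turing machines: the transition function yields a set of actions. -/
structure PTM where
  State : Type
  ι : Type
  finState : Finite State
  finTapes : Finite ι
  io : ι
  start : State
  final : Set State
  δ : State → (ι → Option Bool) → Finset (Action State ι)

namespace PTM

open Classical in
/-- The initial configuration with tape `T` as input. -/
noncomputable def init (M : PTM) (T : Turing.Tape (Option Bool)) : Cfg M.State M.ι where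
  state := M.start
  tapes := fun i => if i = M.io then T else Turing.Tape.mk₁ []

open Classical in
/-- The last configurations of all branches of the computation that starts in `c` and is followed
for `t` steps, one entry for every branch.  A branch ends early if it reaches a final state, or
if no action is possible. -/
noncomputable def branches (M : PTM) : ℕ → Cfg M.State M.ι → Multiset (Cfg M.State M.ι)
  | 0, c => {c}
  | t + 1, c =>
    if c.state ∈ M.final ∨ M.δ c.state c.read = ∅ then {c}
    else (M.δ c.state c.read).val.bind fun a => M.branches t (c.apply a)

/-- Every branch reaches a final state in at most `t` steps. -/
def HaltsWithin (M : PTM) (T : Turing.Tape (Option Bool)) (t : ℕ) : Prop :=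
  ∀ c ∈ M.branches t (M.init T), c.state ∈ M.final

open Classical in
/-- The fraction of accepting branches (halted, with output `1`) among all branches, the branches
being followed for `t` steps. -/
noncomputable def acceptProb (M : PTM) (T : Turing.Tape (Option Bool)) (t : ℕ) : ℝ :=
  ((M.branches t (M.init T)).countP
      fun c => c.state ∈ M.final ∧ TapeShows (c.tapes M.io) [true] : ℝ) /
    (Multiset.card (M.branches t (M.init T)) : ℝ)

end PTM

/-! ## Quantum circuits -/

/-- Elementary gates on `n` qubits; `CNOT c t` has control `c` and target `t`. -/
inductive Gate (n : ℕ) : Type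
  | H (q : Fin n) : Gate n
  | T (q : Fin n) : Gate n
  | CNOT (c t : Fin n) (h : c ≠ t) : Gate n

/-- State vectors of `n` qubits, by their amplitudes in the computational basis. -/
abbrev QState (n : ℕ) := (Fin n → Bool) → ℂ

/-- The Hadamard matrix. -/
noncomputable def hadamard : Matrix Bool Bool ℂ :=
  fun a b => (if a && b then -1 else 1) / (Real.sqrt 2 : ℂ)

/-- The `T` matrix. -/
noncomputable def tMatrix : Matrix Bool Bool ℂ :=
  Matrix.diagonal fun b => if b then Complex.exp (Complex.I * (Real.pi / 4)) else 1

/-- The matrix `G` acting on qubit `q`. -/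
noncomputable def applyOneQubit {n : ℕ} (G : Matrix Bool Bool ℂ) (q : Fin n) (φ : QState n) :
    QState n :=
  fun z => ∑ b : Bool, G (z q) b * φ (Function.update z q b)

/-- The action of a gate on state vectors. -/
noncomputable def Gate.act {n : ℕ} : Gate n → QState n → QState n
  | .H q, φ => applyOneQubit hadamard q φ
  | .T q, φ => applyOneQubit tMatrix q φ
  | .CNOT c t _, φ => fun z => φ (Function.update z t (xor (z t) (z c)))

/-- A circuit on `m` witness qubits followed by `k` ancilla qubits; the gate list is in temporal
order. -/
structure Circuit where
  m : ℕ
  k : ℕ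
  gates : List (Gate (m + k))

namespace Circuit

/-- The state `ψ ⊗ 0^k`. -/
noncomputable def inputState (c : Circuit) (ψ : QState c.m) : QState (c.m + c.k) :=
  fun z => if ∀ j : Fin c.k, z (Fin.natAdd c.m j) = false
    then ψ fun i => z (Fin.castAdd c.k i) else 0

/-- The state after all gates have been applied. -/
noncomputable def outputState (c : Circuit) (ψ : QState c.m) : QState (c.m + c.k) :=
  c.gates.foldl (fun φ g => g.act φ) (c.inputState ψ)

open Classical in
/-- The probability to measure `1` on the first qubit, with witness state `ψ`.  A circuit without
qubits never accepts. -/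
noncomputable def acceptProb (c : Circuit) (ψ : QState c.m) : ℝ :=
  ∑ z : Fin (c.m + c.k) → Bool,
    if ∃ h : 0 < c.m + c.k, z ⟨0, h⟩ = true then ‖c.outputState ψ z‖ ^ 2 else 0

/-- The acceptance probabilities over all classical witnesses. -/
noncomputable def classicalAcceptProbs (c : Circuit) : Set ℝ :=
  {v | ∃ y : Fin c.m → Bool, v = c.acceptProb (Pi.single y 1)}

/-- The acceptance probabilities over all quantum witnesses (unit vectors). -/
noncomputable def quantumAcceptProbs (c : Circuit) : Set ℝ :=
  {v | ∃ ψ : QState c.m, ∑ y, ‖ψ y‖ ^ 2 = 1 ∧ v = c.acceptProb ψ}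

end Circuit

/-- Unary representation, terminated by `0`. -/
def unary (n : ℕ) : Str := List.replicate n true ++ [false]

/-- The code of a gate: its kind (`01`, `10` or `11`), a `0`, and its qubits in unary, counted
from one. -/
def Gate.code {n : ℕ} : Gate n → Str
  | .H q => [false, true, false] ++ unary (q + 1)
  | .T q => [true, false, false] ++ unary (q + 1)
  | .CNOT c t _ => [true, true, false] ++ (unary (c + 1) ++ unary (t + 1))

/-- The code of a circuit: its numbers of witness and ancilla qubits, and its gates. -/
def Circuit.code (c : Circuit) : Str := unary c.m ++ (unary c.k ++ c.gates.flatMap Gate.code)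

theorem unary_append_inj {a b : ℕ} {u v : Str} (h : unary a ++ u = unary b ++ v) :
    a = b ∧ u = v := by
  induction a generalizing b with
  | zero =>
    cases b with
    | zero => simpa [unary] using h
    | succ b => simp [unary, List.replicate_succ] at h
  | succ a ih =>
    cases b with
    | zero => simp [unary, List.replicate_succ] at h
    | succ b =>
      have h2 : unary a ++ u = unary b ++ v := by
        simpa [unary, List.replicate_succ] using h
      obtain ⟨rfl, rfl⟩ := ih h2
      exact ⟨rfl, rfl⟩

theorem Gate.code_append_inj {n : ℕ} {g g' : Gate n} {u v : Str}
    (h : g.code ++ u = g'.code ++ v) : g = g' ∧ u = v := by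
  cases g <;> cases g' <;> simp only [Gate.code, List.append_assoc, List.cons_append,
    List.nil_append, List.cons.injEq, Bool.true_eq_false, Bool.false_eq_true, false_and, and_false,
    true_and] at h
  · obtain ⟨h1, h2⟩ := unary_append_inj h
    simp_all [Fin.ext_iff]
  · obtain ⟨h1, h2⟩ := unary_append_inj h
    simp_all [Fin.ext_iff]
  · obtain ⟨h1, h2⟩ := unary_append_inj h
    obtain ⟨h3, h4⟩ := unary_append_inj h2
    simp_all [Fin.ext_iff]

/-- Different circuits have different codes. -/
theorem Circuit.code_injective : Function.Injective Circuit.code := by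
  rintro ⟨m, k, gs⟩ ⟨m', k', gs'⟩ h
  obtain ⟨h1, h⟩ := unary_append_inj h
  obtain ⟨h2, h⟩ := unary_append_inj h
  dsimp only at h1 h2 h
  subst h1 h2
  suffices key : ∀ gs gs' : List (Gate (m + k)),
      gs.flatMap Gate.code = gs'.flatMap Gate.code → gs = gs' by rw [key gs gs' h]
  clear * -
  intro gs gs' h
  induction gs generalizing gs' with
  | nil => cases gs' with
    | nil => rfl
    | cons g' gs' => cases g' <;> simp [Gate.code] at h
  | cons g gs ih => cases gs' with
    | nil => cases g <;> simp [Gate.code] at h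
    | cons g' gs' =>
      simp only [List.flatMap_cons] at h
      obtain ⟨rfl, ht⟩ := Gate.code_append_inj h
      rw [ih _ ht]

/-- The circuit with a given code, if there is one. -/
noncomputable def decodeCircuit : Str → Option Circuit := Function.partialInv Circuit.code

/-- The acceptance probabilities of the circuit with code `w`, with `probs` picking the kind of
witness.  A string that is not the code of a circuit stands for a circuit that never accepts. -/
noncomputable def codedProbs (probs : Circuit → Set ℝ) (w : Str) : Set ℝ :=
  match decodeCircuit w with
  | some c => probs c
  | none => {0}

/-! ## The machine-based classes and their extremal problems -/

/-- The names of the five classes of promise problems. -/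
inductive BaseClass : Type
  | promiseBPP
  | promiseMA
  | BQP
  | QCMA
  | QMA

/-- What matters about a machine of one of the five classes: for every problem input `x`, the set
of its acceptance probabilities on `x`, where the witness ranges over all admissible witnesses.
For classes without witness this set has one element. -/
abbrev Behaviour := Str → Set ℝ

/-- Circuit families with a witness, on `k + m ∈ poly` qubits and with `m ∈ poly` witness
qubits. -/
def IsVerifierFamily (out : Str → Str) : Prop :=
  PolyTimeComputable out ∧ ∃ k m : ℕ → ℕ, IsPoly m ∧ IsPoly (fun n => k n + m n) ∧
    ∀ x c, decodeCircuit (out x) = some c → c.m = m x.length ∧ c.k = k x.length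

/-- The behaviours of the machines of a class. -/
def BaseClass.behaviours : BaseClass → Set Behaviour
  | promiseBPP => {V | ∃ (M : PTM) (p : Polynomial ℕ),
      (∀ x : Str, M.HaltsWithin (inputTape x) (p.eval x.length)) ∧
      ∀ x : Str, V x = {M.acceptProb (inputTape x) (p.eval x.length)}}
  | promiseMA => {V | ∃ (M : PTM) (p : Polynomial ℕ) (m : ℕ → ℕ), IsPoly m ∧
      (∀ x y : Str, M.HaltsWithin (inputTape₂ x y) (p.eval (x.length + y.length))) ∧
      ∀ x : Str, V x = {v | ∃ y : Str, y.length = m x.length ∧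
        v = M.acceptProb (inputTape₂ x y) (p.eval (x.length + y.length))}}
  | BQP => {V | ∃ out : Str → Str, PolyTimeComputable out ∧
      (∀ x c, decodeCircuit (out x) = some c → c.m = 0) ∧
      ∀ x : Str, V x = codedProbs Circuit.classicalAcceptProbs (out x)}
  | QCMA => {V | ∃ out : Str → Str, IsVerifierFamily out ∧
      ∀ x : Str, V x = codedProbs Circuit.classicalAcceptProbs (out x)}
  | QMA => {V | ∃ out : Str → Str, IsVerifierFamily out ∧
      ∀ x : Str, V x = codedProbs Circuit.quantumAcceptProbs (out x)}

/-- A machine with behaviour `V` decides `A`, with completeness `2/3` and soundness `1/3`. -/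
def Behaviour.Decides (V : Behaviour) (A : PromiseProblem) : Prop :=
  (∀ x ∈ A.yes, ∃ v ∈ V x, 2 / 3 ≤ v) ∧ (∀ x ∈ A.no, ∀ v ∈ V x, v ≤ 1 / 3)

/-- `A` is the extremal problem of a machine with behaviour `V`: it is decided by the machine, and
every problem decided by the machine is a restriction of it. -/
def Behaviour.IsExtremalProblem (V : Behaviour) (A : PromiseProblem) : Prop :=
  V.Decides A ∧ ∀ A' : PromiseProblem, V.Decides A' → A'.IsSubproblem A

/-- `A` is extremal for the class `D`: it is the extremal problem of some machine of `D`. -/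
def IsExtremalFor (D : BaseClass) (A : PromiseProblem) : Prop :=
  ∃ V ∈ D.behaviours, V.IsExtremalProblem A

end UDT

/-!
The diagonal problem `B` coincides with `A` on the strings of some lengths and with `A'` on the
strings of all other lengths (`selectProblem`).  The reduction of `B` to `A ⊕ A'` only has to prefix
a bit that depends on the length, and a machine for `B` only has to find this bit before it behaves
like a machine for `A` or one for `A'`.  Since extremality can be checked string by string
(`isExtremalProblem_iff`), the second remark yields that `B` is extremal; so everything rests on a
set of lengths which is decidable in polynomial time and has sufficiently long gaps.

How long they have to be is a matter of computability.  Because of the closure under finite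
variations, `A` differs from every member of `C` on infinitely many strings (in the case of a
recursively representable class, `A` has infinitely many promised strings at which it is not a
restriction of a given problem of the presentation).  An unbounded search finds such differences
for the first `n` programs of the presentation on strings of length at least `n`, and therefore a
computable `r` bounds their lengths.  If `B` agrees with `A` on the lengths between `n` and `r n` for
infinitely many `n`, then `B` is outside `C` (`exists_gap_bound_of_notMem`).  There is one exception:
if `C` consists of decision problems and `A` is not a decision problem, then `A` may be a finite
variation of a member of `C`.  In this case it is enough that `B` agrees with `A` at some string that
is not promised, which is arranged at the short strings.

The set of lengths comes from a counter machine `D` that runs forever and shows a bit; the bit at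
time `n` decides about the strings of length `n`.  A Turing machine finds it in linear time
(`select`): it sweeps over the input while it performs one step of `D` per symbol, a counter being a
tape with a marker, where the position of the head is the value.  It remains to construct `D` such
that each of its phases, in which the bit is constant, lasts until time `r n` if it begins at time
`n` (`CounterMachine.exists_out_gaps`).  The machine has to know the time for this purpose.  It has a
clock, which at the beginning of a phase contains a value `v` with `n ≤ 2 v`.  The clock is emptied
into the input register of a program for a function `f`; it restarts while this program runs, and
then the result `f v` is added to it.  If the program makes `t` steps, the phase lasts
`v + t + f v + 2` steps and leaves the value `t + f v` in the clock, so that the bound on the time is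
preserved for `f v ≥ 3 v + 2`.  The phase is long enough if `f v` bounds `r` on all arguments up to
`2 v`.

The program for `f` is a while program over finitely many registers
(`WhileProg.exists_exec_of_computable_finite`), which is obtained by induction on the definition of
`f` as a partial recursive function.
-/

namespace UDT

/-! ### While programs -/

/-- While programs over registers indexed by `R`, each holding a natural number. -/
inductive WhileProg (R : Type) : Type
  | inc (r : R)
  | dec (r : R)
  | seq (p q : WhileProg R)
  | loop (r : R) (p : WhileProg R)

namespace WhileProg

open Function

/-- `Exec p σ τ`: the program `p`, started on the register contents `σ`, terminates with the
register contents `τ`.  `loop r p` repeats `p` as long as register `r` is nonzero. -/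
inductive Exec {R : Type} [DecidableEq R] : WhileProg R → (R → ℕ) → (R → ℕ) → Prop
  | inc (r σ) : Exec (inc r) σ (update σ r (σ r + 1))
  | dec (r σ) : Exec (dec r) σ (update σ r (σ r - 1))
  | seq {p q σ τ υ} : Exec p σ τ → Exec q τ υ → Exec (seq p q) σ υ
  | loop_zero {r p σ} : σ r = 0 → Exec (loop r p) σ σ
  | loop_succ {r p σ τ υ} : σ r ≠ 0 → Exec p σ τ → Exec (loop r p) τ υ → Exec (loop r p) σ υ

theorem Exec.of_eq {R : Type} [DecidableEq R] {p : WhileProg R} {σ τ τ' : R → ℕ}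
    (h : Exec p σ τ) (e : τ = τ') : Exec p σ τ' := e ▸ h

/-- The program that does nothing. -/
def skip : WhileProg ℕ := seq (inc 0) (dec 0)

theorem exec_skip (σ : ℕ → ℕ) : Exec skip σ σ :=
  (Exec.seq (.inc 0 σ) (.dec 0 _)).of_eq (by simp)

/-- Set register `r` to zero. -/
def clear (r : ℕ) : WhileProg ℕ := loop r (dec r)

theorem exec_clear (r : ℕ) (σ : ℕ → ℕ) : Exec (clear r) σ (update σ r 0) := by
  induction h : σ r generalizing σ with
  | zero => exact (Exec.loop_zero h).of_eq (by rw [← h, update_eq_self])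
  | succ n ih =>
    exact .loop_succ (by omega) (.dec r σ) ((ih _ (by simp [h])).of_eq (by simp))

/-- Add the contents of register `a` to register `b`, and clear `a`. -/
def move (a b : ℕ) : WhileProg ℕ := loop a (seq (dec a) (inc b))

theorem exec_move {a b : ℕ} (hab : a ≠ b) (σ : ℕ → ℕ) :
    Exec (move a b) σ (update (update σ b (σ b + σ a)) a 0) := by
  induction h : σ a generalizing σ with
  | zero => exact (Exec.loop_zero h).of_eq (by funext j; by_cases j = a <;> simp_all)
  | succ n ih =>
    refine .loop_succ (by omega) (.seq (.dec a σ) (.inc b _)) ((ih _ ?_).of_eq ?_)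
    · simp [hab, h]
    · funext j
      by_cases h1 : j = a <;> by_cases h2 : j = b <;> simp_all [Ne.symm hab]
      omega

/-- Move the contents of register `a` to both `b` and `c`. -/
def fork (a b c : ℕ) : WhileProg ℕ := loop a (seq (dec a) (seq (inc b) (inc c)))

theorem exec_fork {a b c : ℕ} (hab : a ≠ b) (hac : a ≠ c) (hbc : b ≠ c) (σ : ℕ → ℕ) :
    Exec (fork a b c) σ
      (update (update (update σ b (σ b + σ a)) c (σ c + σ a)) a 0) := by
  induction h : σ a generalizing σ with
  | zero =>
    exact (Exec.loop_zero h).of_eq (by funext j; by_cases j = a <;> simp_all)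
  | succ n ih =>
    refine .loop_succ (by omega) (.seq (.dec a σ) (.seq (.inc b _) (.inc c _)))
      ((ih _ ?_).of_eq ?_)
    · simp [hab, hac, h]
    · funext j
      by_cases h1 : j = a
      · simp [h1]
      by_cases h2 : j = b
      · subst h2; simp [h1, hbc]; omega
      by_cases h3 : j = c
      · subst h3; simp [h1, h2]; omega
      simp [h1, h2, h3]

/-- Add the contents of register `a` to register `b`, with the help of the empty register `k`. -/
def copy (a b k : ℕ) : WhileProg ℕ := seq (fork a b k) (move k a)

theorem exec_copy {a b k : ℕ} (hab : a ≠ b) (hak : a ≠ k) (hbk : b ≠ k) {σ : ℕ → ℕ}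
    (hk : σ k = 0) : Exec (copy a b k) σ (update σ b (σ b + σ a)) := by
  refine .seq (exec_fork hab hak hbk σ) ((exec_move hak.symm _).of_eq ?_)
  funext j
  by_cases h3 : j = k
  · subst h3; simp [hk, hbk.symm]
  by_cases h1 : j = a
  · subst h1; simp [hak, hak.symm, hab, hk]
  by_cases h2 : j = b <;> simp [h1, h2, h3]
  simp [hbk, hab.symm]

/-! ### Partial recursive functions as while programs -/

/-- `f` is computed by while programs, uniformly in the choice of the registers: the arguments are
in the registers `ins i`, the result appears in register `o`, and registers from `k` on are scratch
space.  All registers but `o` end with their initial contents. -/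
def Computes {n : ℕ} (f : List.Vector ℕ n →. ℕ) : Prop :=
  ∀ (ins : Fin n → ℕ) (o k : ℕ), (∀ i, ins i < k) → o < k → (∀ i, ins i ≠ o) →
    ∃ p : WhileProg ℕ, ∀ σ : ℕ → ℕ, σ o = 0 → (∀ j, k ≤ j → σ j = 0) →
      ∀ y ∈ f (List.Vector.ofFn fun i => σ (ins i)), Exec p σ (update σ o y)

theorem Computes.of_eq {n : ℕ} {f g : List.Vector ℕ n →. ℕ} (hf : Computes f)
    (h : ∀ v, f v = g v) : Computes g := (funext h : f = g) ▸ hf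

theorem computes_zero : Computes (n := 0) (fun _ => Part.some 0) := by
  intro ins o k _ _ _
  refine ⟨skip, fun σ ho _ y hy => (exec_skip σ).of_eq ?_⟩
  obtain rfl : y = 0 := by simpa using hy
  rw [← ho, update_eq_self]

theorem computes_get {n : ℕ} (i : Fin n) : Computes (fun v => Part.some (v.get i)) := by
  intro ins o k hins hok hne
  refine ⟨copy (ins i) o k, fun σ ho hk y hy =>
    (exec_copy (hne i) (hins i).ne hok.ne (hk k le_rfl)).of_eq ?_⟩
  obtain rfl : y = σ (ins i) := by simpa using hy
  simp [ho]

theorem computes_succ : Computes (n := 1) (fun v => Part.some v.head.succ) := by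
  intro ins o k hins hok hne
  refine ⟨seq (copy (ins 0) o k) (inc o), fun σ ho hk y hy =>
    (Exec.seq (exec_copy (hne 0) (hins 0).ne hok.ne (hk k le_rfl)) (.inc _ _)).of_eq ?_⟩
  obtain rfl : y = σ (ins 0) + 1 := by simpa [List.Vector.ofFn] using hy
  simp [ho]

theorem exists_get_mem_of_mem_mOfFn {n : ℕ} {g : Fin n → Part ℕ} {w : List.Vector ℕ n}
    (h : w ∈ List.Vector.mOfFn g) (i : Fin n) : w.get i ∈ g i := by
  induction n with
  | zero => exact i.elim0
  | succ n ih =>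
    simp only [List.Vector.mOfFn, Part.bind_eq_bind, Part.mem_bind_iff] at h
    obtain ⟨a, ha, v, hv, hw⟩ := h
    obtain rfl : w = a ::ᵥ v := by simpa using hw
    refine Fin.cases ?_ (fun i => ?_) i
    · simpa using ha
    · simpa using ih hv i

/-- Clear the registers `k, …, k + m - 1`. -/
theorem exists_clear_range (k m : ℕ) : ∃ p : WhileProg ℕ, ∀ σ : ℕ → ℕ,
    Exec p σ (fun x => if k ≤ x ∧ x < k + m then 0 else σ x) := by
  induction m with
  | zero =>
    refine ⟨skip, fun σ => (exec_skip σ).of_eq ?_⟩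
    funext x
    rw [if_neg (by omega)]
  | succ m ih =>
    obtain ⟨p, hp⟩ := ih
    refine ⟨seq p (clear (k + m)), fun σ => (Exec.seq (hp σ) (exec_clear _ _)).of_eq ?_⟩
    funext x
    by_cases h : x = k + m
    · subst h; simp
    · have : (k ≤ x ∧ x < k + (m + 1)) ↔ (k ≤ x ∧ x < k + m) := by omega
      simp [h, this]

/-- Compute several values, one after the other, into the registers `k, …, k + m - 1`. -/
theorem exists_eval_range {n m : ℕ} {g : Fin m → List.Vector ℕ n →. ℕ}
    (hg : ∀ i, Computes (g i)) (ins : Fin n → ℕ) (k : ℕ) (hins : ∀ i, ins i < k) (j : ℕ)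
    (hj : j ≤ m) : ∃ p : WhileProg ℕ, ∀ σ : ℕ → ℕ, (∀ x, k ≤ x → σ x = 0) →
      ∀ w : ℕ → ℕ, (∀ i : Fin m, w i ∈ g i (List.Vector.ofFn fun i => σ (ins i))) →
        Exec p σ (fun x => if k ≤ x ∧ x < k + j then w (x - k) else σ x) := by
  induction j with
  | zero =>
    refine ⟨skip, fun σ _ w _ => (exec_skip σ).of_eq ?_⟩
    funext x
    rw [if_neg (by omega)]
  | succ j ih =>
    obtain ⟨p, hp⟩ := ih (by omega)
    obtain ⟨q, hq⟩ := hg ⟨j, hj⟩ ins (k + j) (k + m) (fun i => (hins i).trans_le (by omega))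
      (by omega) (fun i => ((hins i).trans_le (by omega)).ne)
    refine ⟨seq p q, fun σ hσ w hw => (Exec.seq (hp σ hσ w hw) (hq _ ?_ ?_ (w j) ?_)).of_eq ?_⟩
    · simp [hσ]
    · intro x hx
      rw [if_neg (by omega), hσ x (by omega)]
    · have : (fun i => if k ≤ ins i ∧ ins i < k + j then w (ins i - k) else σ (ins i))
          = fun i => σ (ins i) := by
        funext i
        have := hins i
        rw [if_neg (by omega)]
      rw [this]
      exact hw ⟨j, hj⟩
    · funext x
      by_cases h : x = k + j
      · subst h; simp
      · have : (k ≤ x ∧ x < k + (j + 1)) ↔ (k ≤ x ∧ x < k + j) := by omega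
        simp [h, this]

theorem Computes.comp {n m : ℕ} {f : List.Vector ℕ m →. ℕ} {g : Fin m → List.Vector ℕ n →. ℕ}
    (hf : Computes f) (hg : ∀ i, Computes (g i)) :
    Computes (fun v => (List.Vector.mOfFn fun i => g i v) >>= f) := by
  intro ins o k hins hok hne
  obtain ⟨p, hp⟩ := exists_eval_range hg ins k hins m le_rfl
  obtain ⟨q, hq⟩ := hf (fun i => k + i) o (k + m) (fun i => by simp) (by omega)
    (fun i => by omega)
  obtain ⟨c, hc⟩ := exists_clear_range k m
  refine ⟨seq p (seq q c), fun σ ho hk y hy => ?_⟩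
  obtain ⟨w, hw, hy⟩ := Part.mem_bind_iff.1 hy
  have hw' := fun i => exists_get_mem_of_mem_mOfFn hw i
  let u : ℕ → ℕ := fun j => if h : j < m then w.get ⟨j, h⟩ else 0
  refine .seq (hp σ hk u fun i => ?_) (.seq (hq _ ?_ ?_ y ?_) ((hc _).of_eq ?_))
  · simpa [u] using hw' i
  · rw [if_neg (by omega), ho]
  · intro x hx
    rw [if_neg (by omega), hk x (by omega)]
  · convert hy
    refine List.Vector.ext fun i => ?_
    simp [u]
  · funext x
    by_cases h : x = o
    · subst h
      rw [if_neg (by omega)]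
      simp
    · by_cases h2 : k ≤ x ∧ x < k + m
      · simp [h, h2, hk x h2.1]
      · simp [h, h2]

theorem Computes.prec {n : ℕ} {f : List.Vector ℕ n → ℕ} {g : List.Vector ℕ (n + 2) → ℕ}
    (hf : Computes (fun v => Part.some (f v))) (hg : Computes (fun v => Part.some (g v))) :
    Computes (n := n + 1) (fun v => Part.some
      (v.head.rec (f v.tail) fun y IH => g (y ::ᵥ IH ::ᵥ v.tail))) := by
  intro ins o k hins hok hne
  -- `k` holds the accumulator, `k + 1` the index, `k + 2` the remaining number of rounds
  obtain ⟨p, hp⟩ := hf (fun i => ins i.succ) k (k + 4) (fun i => (hins _).trans (by omega))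
    (by omega) (fun i => (hins _).ne)
  obtain ⟨q, hq⟩ := hg (Fin.cons (k + 1) (Fin.cons k fun i => ins i.succ)) (k + 3) (k + 4)
    (by
      refine Fin.cases (by simp) (Fin.cases (by simp) fun i => ?_)
      simpa using (hins i.succ).trans (by omega))
    (by omega)
    (by
      refine Fin.cases (by simp) (Fin.cases (by simp) fun i => ?_)
      simpa using ((hins i.succ).trans (by omega)).ne)
  refine ⟨seq p (seq (copy (ins 0) (k + 2) (k + 4)) (seq
    (loop (k + 2) (seq (dec (k + 2)) (seq q (seq (clear k) (seq (move (k + 3) k) (inc (k + 1)))))))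
    (seq (move k o) (clear (k + 1))))), fun σ ho hk y hy => ?_⟩
  let v : List.Vector ℕ n := List.Vector.ofFn fun i => σ (ins i.succ)
  let F : ℕ → ℕ := fun a => a.rec (f v) fun y IH => g (y ::ᵥ IH ::ᵥ v)
  let S : ℕ → ℕ → ℕ → ℕ := fun i c x =>
    if x = k then F i else if x = k + 1 then i else if x = k + 2 then c else σ x
  have hy' : y = F (σ (ins 0)) := by simpa [F, v, List.Vector.ofFn] using hy
  have hround : ∀ c i, Exec (loop (k + 2) (seq (dec (k + 2)) (seq q (seq (clear k)
      (seq (move (k + 3) k) (inc (k + 1))))))) (S i c) (S (i + c) 0) := by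
    intro c
    induction c with
    | zero => exact fun i => .loop_zero (by simp [S])
    | succ c ih =>
      intro i
      refine .loop_succ (by simp [S]) ?_ ((ih (i + 1)).of_eq (by rw [add_right_comm, add_assoc]))
      refine .seq (.dec _ _) (.seq (hq _ ?_ ?_ (F (i + 1)) ?_) (.seq (exec_clear _ _)
        (.seq (exec_move (by omega) _) ((Exec.inc _ _).of_eq ?_))))
      · simp [S, hk]
      · intro x hx
        rw [update_of_ne (by omega)]
        simp only [S]
        rw [if_neg (by omega), if_neg (by omega), if_neg (by omega), hk x (by omega)]
      · have : (fun i_1 : Fin n => update (S i (c + 1)) (k + 2) (S i (c + 1) (k + 2) - 1)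
            (ins i_1.succ)) = fun i => σ (ins i.succ) := by
          funext j
          have := hins j.succ
          rw [update_of_ne (by omega)]
          simp only [S]
          rw [if_neg (by omega), if_neg (by omega), if_neg (by omega)]
        simp only [List.Vector.ofFn, Fin.cons_zero, Fin.cons_succ, this, Part.mem_some_iff]
        simp [S, F, v]
      · funext x
        by_cases h1 : x = k
        · subst h1; simp [S]
        by_cases h2 : x = k + 1
        · subst h2; simp [S]
        by_cases h3 : x = k + 2
        · subst h3; simp [S]
        by_cases h4 : x = k + 3
        · subst h4; simp [S, hk]
        simp [S, h1, h2, h3, h4]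
  refine .seq (hp σ (hk k le_rfl) (fun j hj => hk j (by omega)) (F 0) (by simp [F, v]))
    (.seq (exec_copy (a := ins 0) (b := k + 2) (k := k + 4) ?_ ?_ (by omega) ?_)
    (.seq (τ := S (σ (ins 0)) 0) ?_
    (.seq (exec_move hok.ne' _) ((exec_clear _ _).of_eq ?_))))
  · have := hins 0; omega
  · have := hins 0; omega
  · simp [hk]
  · have := hround (σ (ins 0)) 0
    rw [zero_add] at this
    convert this using 1
    funext x
    by_cases h1 : x = k
    · subst h1; simp [S]
    by_cases h2 : x = k + 1
    · subst h2; simp [S, hk]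
    by_cases h3 : x = k + 2
    · subst h3; simp [S, hk, (hins 0).ne]
    simp [S, h1, h2, h3]
  · funext x
    have h5 : o ≠ k + 1 := by omega
    have h6 : o ≠ k + 2 := by omega
    by_cases h0 : x = o
    · subst h0; simp [S, hok.ne, h5, h6, ho, hy']
    by_cases h1 : x = k
    · subst h1; simp [h0, hk]
    by_cases h2 : x = k + 1
    · subst h2; simp [h0, hk]
    by_cases h3 : x = k + 2
    · subst h3; simp [S, h0, hk]
    simp [S, h0, h1, h2, h3]

theorem Computes.rfind {n : ℕ} {f : List.Vector ℕ (n + 1) → ℕ}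
    (hf : Computes (fun v => Part.some (f v))) :
    Computes (fun v => Nat.rfind fun n => Part.some (decide (f (n ::ᵥ v) = 0))) := by
  intro ins o k hins hok hne
  -- `k` holds the candidate and `k + 1` the value of `f` there
  obtain ⟨q, hq⟩ := hf (Fin.cons k ins) (k + 1) (k + 2)
    (by
      refine Fin.cases (by simp) fun i => ?_
      simpa using (hins i).trans (by omega))
    (by omega)
    (by
      refine Fin.cases (by simp) fun i => ?_
      simpa using ((hins i).trans (by omega)).ne)
  refine ⟨seq q (seq (loop (k + 1) (seq (clear (k + 1)) (seq (inc k) q))) (move k o)),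
    fun σ ho hk y hy => ?_⟩
  let v : List.Vector ℕ n := List.Vector.ofFn fun i => σ (ins i)
  let S : ℕ → ℕ → ℕ := fun i x => if x = k then i else if x = k + 1 then f (i ::ᵥ v) else σ x
  have hval : ∀ τ : ℕ → ℕ, ∀ i, (∀ x, x ≠ k → τ x = σ x) → τ k = i → Exec q τ (S i) := by
    intro τ i hτ hi
    refine (hq τ ?_ ?_ (f (i ::ᵥ v)) ?_).of_eq ?_
    · rw [hτ _ (by omega), hk _ (by omega)]
    · intro j hj
      rw [hτ _ (by omega), hk _ (by omega)]
    · have : (fun i => τ (ins i)) = fun i => σ (ins i) := funext fun j => hτ _ (hins j).ne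
      simp [List.Vector.ofFn, hi, this, v]
    · funext x
      by_cases h1 : x = k
      · subst h1; simp [S, hi]
      by_cases h2 : x = k + 1
      · subst h2; simp [S]
      simp [S, h1, h2, hτ]
  have hy1 : f (y ::ᵥ v) = 0 := by simpa [v] using Nat.rfind_spec hy
  have hy2 : ∀ m < y, f (m ::ᵥ v) ≠ 0 := fun m hm => by simpa [v] using Nat.rfind_min hy hm
  have hround : ∀ c i, i + c = y →
      Exec (loop (k + 1) (seq (clear (k + 1)) (seq (inc k) q))) (S i) (S y) := by
    intro c
    induction c with
    | zero =>
      rintro i rfl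
      exact .loop_zero (by simpa [S] using hy1)
    | succ c ih =>
      intro i hi
      refine .loop_succ (by simpa [S] using hy2 i (by omega)) (.seq (exec_clear _ _)
        (.seq (.inc _ _) (hval _ (i + 1) ?_ ?_))) (ih (i + 1) (by omega))
      · intro x hx
        by_cases h2 : x = k + 1
        · subst h2; simp [hk]
        simp [S, hx, h2]
      · simp [S]
  refine .seq (hval σ 0 (fun _ _ => rfl) (hk k le_rfl)) (.seq (hround y 0 (by omega))
    ((exec_move hok.ne' _).of_eq ?_))
  funext x
  have h5 : o ≠ k + 1 := by omega
  by_cases h0 : x = o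
  · subst h0; simp [S, hok.ne, h5, ho]
  by_cases h1 : x = k
  · subst h1; simp [h0, hk]
  by_cases h2 : x = k + 1
  · subst h2; simp [S, h0, hy1, hk]
  simp [S, h0, h1, h2]

theorem computes_of_primrec' {n : ℕ} {f : List.Vector ℕ n → ℕ} (hf : Nat.Primrec' f) :
    Computes (fun v => Part.some (f v)) := by
  induction hf with
  | zero => exact computes_zero
  | succ => exact computes_succ
  | get i => exact computes_get i
  | comp g _ _ hf hg =>
    refine (Computes.comp hf hg).of_eq fun v => ?_
    rw [Vector.mOfFn_part_some]
    exact Part.bind_some _ _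
  | prec _ _ hf hg => exact hf.prec hg

theorem computes_of_partrec' {n : ℕ} {f : List.Vector ℕ n →. ℕ} (hf : Nat.Partrec' f) :
    Computes f := by
  induction hf with
  | prim hf => exact computes_of_primrec' hf
  | comp g _ _ hf hg => exact hf.comp hg
  | rfind _ hf => exact hf.rfind

/-- Every computable function is computed by a while program that takes its argument from
register `0`, puts the result into register `1`, and cleans up all other registers. -/
theorem exists_exec_of_computable {f : ℕ → ℕ} (hf : Computable f) : ∃ p : WhileProg ℕ, ∀ v,
    Exec p (update (fun _ => 0) 0 v) (update (fun _ => 0) 1 (f v)) := by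
  obtain ⟨p, hp⟩ := computes_of_partrec' (Nat.Partrec'.part_iff₁.2 hf) (fun _ => 0) 1 2
    (by simp) (by simp) (by simp)
  refine ⟨seq p (clear 0), fun v => (Exec.seq (hp _ (by simp) ?_ (f v) ?_)
    (exec_clear _ _)).of_eq ?_⟩
  · intro j hj
    rw [update_of_ne (by omega)]
  · simp [List.Vector.ofFn]
  · funext x
    by_cases h0 : x = 0
    · subst h0; simp
    by_cases h1 : x = 1 <;> simp [h0, h1]

end WhileProg

/-! ### Small steps of while programs -/

/-- The effect of a head movement on a counter; a counter at zero cannot be decreased. -/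
def shiftCounter : Option Turing.Dir → ℕ → ℕ
  | none, v => v
  | some .left, v => v - 1
  | some .right, v => v + 1

namespace WhileProg

open Function

variable {R : Type}

/-- The control points of a program. -/
def Point : WhileProg R → Type
  | inc _ => Unit
  | dec _ => Unit
  | seq p q => Point p ⊕ Point q
  | loop _ p => Option (Point p)

instance finite_point (p : WhileProg R) : Finite p.Point := by
  induction p with
  | inc r => exact inferInstanceAs (Finite Unit)
  | dec r => exact inferInstanceAs (Finite Unit)
  | seq p q hp hq => exact inferInstanceAs (Finite (p.Point ⊕ q.Point))
  | loop r p hp => exact inferInstanceAs (Finite (Option p.Point))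

/-- The control point at which a program starts. -/
def entry : (p : WhileProg R) → p.Point
  | inc _ => ()
  | dec _ => ()
  | seq p _ => Sum.inl p.entry
  | loop _ _ => none

/-- One step of a program, given which registers are zero: the next control point (`none` if the
program terminates), and the changes of the registers. -/
def next [DecidableEq R] :
    (p : WhileProg R) → p.Point → (R → Bool) → Option p.Point × (R → Option Turing.Dir)
  | inc r, _, _ => (none, update (fun _ => none) r (some .right))
  | dec r, _, _ => (none, update (fun _ => none) r (some .left))
  | seq p q, .inl s, z =>
    (some (((p.next s z).1.map Sum.inl).getD (Sum.inr q.entry)), (p.next s z).2)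
  | seq _ q, .inr s, z => ((q.next s z).1.map Sum.inr, (q.next s z).2)
  | loop r p, none, z => (if z r then none else some (some p.entry), fun _ => none)
  | loop _ p, some s, z => (some (p.next s z).1, (p.next s z).2)

/-- `Run p s σ t τ`: from the control point `s` and the register contents `σ`, the program
terminates after exactly `t` steps with the register contents `τ`. -/
inductive Run [DecidableEq R] (p : WhileProg R) : p.Point → (R → ℕ) → ℕ → (R → ℕ) → Prop
  | exit {s σ τ} : (p.next s fun r => decide (σ r = 0)).1 = none →
      (τ = fun r => shiftCounter ((p.next s fun r => decide (σ r = 0)).2 r) (σ r)) →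
      Run p s σ 1 τ
  | cont {s s' σ σ' t τ} : (p.next s fun r => decide (σ r = 0)).1 = some s' →
      (σ' = fun r => shiftCounter ((p.next s fun r => decide (σ r = 0)).2 r) (σ r)) →
      Run p s' σ' t τ → Run p s σ (t + 1) τ

variable [DecidableEq R]

theorem Run.inr {p q : WhileProg R} {s : q.Point} {σ τ : R → ℕ} {t : ℕ} (h : Run q s σ t τ) :
    Run (seq p q) (Sum.inr s) σ t τ := by
  induction h with
  | exit h1 h2 => exact .exit (by simp only [next, h1]; rfl) h2
  | cont h1 h2 _ ih => exact .cont (by simp only [next, h1]; rfl) h2 ih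

theorem Run.seq {p q : WhileProg R} {s : p.Point} {σ τ υ : R → ℕ} {t u : ℕ}
    (h : Run p s σ t τ) (h' : Run q q.entry τ u υ) :
    Run (seq p q) (Sum.inl s) σ (u + t) υ := by
  induction h with
  | exit h1 h2 => exact .cont (by simp only [next, h1]; rfl) h2 h'.inr
  | cont h1 h2 _ ih => exact .cont (by simp only [next, h1]; rfl) h2 (ih h')

theorem Run.loop {r : R} {p : WhileProg R} {s : p.Point} {σ τ υ : R → ℕ} {t u : ℕ}
    (h : Run p s σ t τ) (h' : Run (loop r p) none τ u υ) :
    Run (loop r p) (some s) σ (u + t) υ := by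
  induction h with
  | exit h1 h2 => exact .cont (by simp only [next, h1]) h2 h'
  | cont h1 h2 _ ih => exact .cont (by simp only [next, h1]) h2 (ih h')

theorem Exec.exists_run {p : WhileProg R} {σ τ : R → ℕ} (h : Exec p σ τ) :
    ∃ t, Run p p.entry σ t τ := by
  induction h with
  | inc r σ =>
    refine ⟨1, .exit rfl ?_⟩
    funext x
    by_cases hx : x = r
    · subst hx; simp [next, shiftCounter]
    · simp [next, shiftCounter, hx]
  | dec r σ =>
    refine ⟨1, .exit rfl ?_⟩
    funext x
    by_cases hx : x = r
    · subst hx; simp [next, shiftCounter]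
    · simp [next, shiftCounter, hx]
  | seq _ _ ih1 ih2 =>
    obtain ⟨t, ht⟩ := ih1
    obtain ⟨u, hu⟩ := ih2
    exact ⟨_, ht.seq hu⟩
  | loop_zero h0 => exact ⟨1, .exit (by simp [next, entry, h0]) (by simp [next, entry, shiftCounter])⟩
  | loop_succ h0 _ _ ih1 ih2 =>
    obtain ⟨t, ht⟩ := ih1
    obtain ⟨u, hu⟩ := ih2
    exact ⟨_, .cont (by simp [next, entry, h0]) (by simp [next, entry, shiftCounter])
      (ht.loop hu)⟩

/-! ### Restriction to finitely many registers -/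

/-- Rename the registers of a program. -/
def map {R' : Type} (f : R → R') : WhileProg R → WhileProg R'
  | inc r => inc (f r)
  | dec r => dec (f r)
  | seq p q => seq (p.map f) (q.map f)
  | loop r p => loop (f r) (p.map f)

/-- The registers that occur in a program. -/
def regs : WhileProg R → Finset R
  | inc r => {r}
  | dec r => {r}
  | seq p q => p.regs ∪ q.regs
  | loop r p => insert r p.regs

theorem Exec.map {R' : Type} [DecidableEq R'] {f : R → R'} {g : R' → R} (hg : Injective g)
    {p : WhileProg R} {σ τ : R → ℕ} (h : Exec p σ τ) (hp : ∀ r ∈ p.regs, g (f r) = r) :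
    Exec (p.map f) (σ ∘ g) (τ ∘ g) := by
  induction h with
  | inc r σ =>
    have hr : g (f r) = r := hp r (by simp [regs])
    refine (Exec.inc (f r) _).of_eq ?_
    rw [comp_apply, hr]
    conv_rhs => rw [← hr]
    rw [update_comp_eq_of_injective _ hg, hr]
  | dec r σ =>
    have hr : g (f r) = r := hp r (by simp [regs])
    refine (Exec.dec (f r) _).of_eq ?_
    rw [comp_apply, hr]
    conv_rhs => rw [← hr]
    rw [update_comp_eq_of_injective _ hg, hr]
  | seq _ _ ih1 ih2 =>
    exact .seq (ih1 fun r hr => hp r (by simp [regs, hr])) (ih2 fun r hr => hp r (by simp [regs, hr]))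
  | loop_zero h0 => exact .loop_zero (by rwa [comp_apply, hp _ (by simp [regs])])
  | loop_succ h0 _ _ ih1 ih2 =>
    exact .loop_succ (by rwa [comp_apply, hp _ (by simp [regs])])
      (ih1 fun r hr => hp r (by simp [regs, hr])) (ih2 hp)

theorem exists_exec_of_computable_finite {f : ℕ → ℕ} (hf : Computable f) :
    ∃ (R : Type) (_ : Finite R) (_ : DecidableEq R) (i o : R) (p : WhileProg R),
      ∀ v, Exec p (update (fun _ => 0) i v) (update (fun _ => 0) o (f v)) := by
  obtain ⟨p, hp⟩ := exists_exec_of_computable hf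
  let s : Finset ℕ := {0, 1} ∪ p.regs
  let i : s := ⟨0, by simp [s]⟩
  let o : s := ⟨1, by simp [s]⟩
  refine ⟨s, inferInstance, inferInstance, i, o,
    p.map fun r => if h : r ∈ s then ⟨r, h⟩ else i, fun v => ?_⟩
  have := (hp v).map (f := fun r => if h : r ∈ s then ⟨r, h⟩ else i) (g := ((↑) : s → ℕ))
    Subtype.val_injective (fun r hr => by rw [dif_pos (by simp [s, hr])])
  have e1 := update_comp_eq_of_injective (fun _ => 0) (f := ((↑) : s → ℕ))
    Subtype.val_injective i v
  have e2 := update_comp_eq_of_injective (fun _ => 0) (f := ((↑) : s → ℕ))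
    Subtype.val_injective o (f v)
  simp only [i, o] at e1 e2
  rwa [e1, e2] at this

end WhileProg

/-! ### Counter machines -/

/-- A counter machine without input that runs forever and shows a bit at any time.  In every step
it sees which of its counters are zero, and it can change all counters by one. -/
structure CounterMachine where
  State : Type
  ι : Type
  finState : Finite State
  finCounters : Finite ι
  start : State
  bit : State → Bool
  next : State → (ι → Bool) → State × (ι → Option Turing.Dir)

namespace CounterMachine

/-- One step of a counter machine. -/
def step (D : CounterMachine) (c : D.State × (D.ι → ℕ)) : D.State × (D.ι → ℕ) :=
  ((D.next c.1 fun i => decide (c.2 i = 0)).1,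
    fun i => shiftCounter ((D.next c.1 fun i => decide (c.2 i = 0)).2 i) (c.2 i))

/-- The configuration after `n` steps. -/
def cfg (D : CounterMachine) (n : ℕ) : D.State × (D.ι → ℕ) := D.step^[n] (D.start, fun _ => 0)

/-- The bit shown after `n` steps. -/
def out (D : CounterMachine) (n : ℕ) : Bool := D.bit (D.cfg n).1

theorem cfg_succ (D : CounterMachine) (n : ℕ) : D.cfg (n + 1) = D.step (D.cfg n) :=
  Function.iterate_succ_apply' _ _ _

theorem computable_out (D : CounterMachine) : Computable D.out := by
  have := D.finState
  have := D.finCounters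
  obtain ⟨m, ⟨eS⟩⟩ := Finite.exists_equiv_fin D.State
  obtain ⟨n, ⟨eι⟩⟩ := Finite.exists_equiv_fin D.ι
  -- the step function on configurations in which states and counters are numbered
  let nx : Fin m × (Fin n → Bool) → D.State × (D.ι → Option Turing.Dir) :=
    fun a => D.next (eS.symm a.1) (a.2 ∘ eι)
  let F : Fin m × (Fin n → ℕ) → Fin m × (Fin n → ℕ) := fun c =>
    (eS (nx (c.1, fun i => decide (c.2 i = 0))).1, fun i =>
      c.2 i + (if (nx (c.1, fun i => decide (c.2 i = 0))).2 (eι.symm i) = some .right then 1 else 0)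
        - (if (nx (c.1, fun i => decide (c.2 i = 0))).2 (eι.symm i) = some .left then 1 else 0))
  have hz : Primrec fun c : Fin m × (Fin n → ℕ) => (c.1, fun i => decide (c.2 i = 0)) := by
    refine Primrec.fst.pair (Primrec.fin_curry.2 ?_)
    exact (Primrec.eq.decide.comp (Primrec.fin_app.comp (Primrec.snd.comp Primrec.fst) Primrec.snd)
      (Primrec.const 0)).to₂
  have hF : Primrec F := by
    refine Primrec.pair ((Primrec.dom_finite fun a => eS (nx a).1).comp hz)
      (Primrec.fin_curry.2 ?_)
    have h2 : Primrec fun c : (Fin m × (Fin n → ℕ)) × Fin n =>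
        ((c.1.1, fun i => decide (c.1.2 i = 0)), c.2) :=
      (hz.comp Primrec.fst).pair Primrec.snd
    exact (Primrec.nat_sub.comp (Primrec.nat_add.comp
      (Primrec.fin_app.comp (Primrec.snd.comp Primrec.fst) Primrec.snd)
      ((Primrec.dom_finite fun a : (Fin m × (Fin n → Bool)) × Fin n =>
        if (nx a.1).2 (eι.symm a.2) = some .right then 1 else 0).comp h2))
      ((Primrec.dom_finite fun a : (Fin m × (Fin n → Bool)) × Fin n =>
        if (nx a.1).2 (eι.symm a.2) = some .left then 1 else 0).comp h2)).to₂
  let φ : D.State × (D.ι → ℕ) → Fin m × (Fin n → ℕ) := fun c => (eS c.1, c.2 ∘ eι.symm)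
  have hφ : Function.Semiconj φ D.step F := by
    intro c
    have e : ((fun i => decide (c.2 (eι.symm i) = 0)) ∘ eι) = fun i => decide (c.2 i = 0) := by
      funext i; simp
    refine Prod.ext ?_ (funext fun i => ?_)
    · simp [φ, F, nx, step, e]
    · simp only [φ, F, nx, step, Function.comp_apply, Equiv.symm_apply_apply, e]
      generalize (D.next c.1 fun i => decide (c.2 i = 0)).2 (eι.symm i) = d
      rcases d with _ | d | d <;> simp [shiftCounter]
  have hout : D.out = fun k => D.bit (eS.symm (F^[k] (φ (D.start, fun _ => 0))).1) := by
    funext k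
    rw [← (hφ.iterate_right k).eq]
    simp [φ, out, cfg]
  rw [hout]
  exact ((Primrec.dom_finite fun s => D.bit (eS.symm s)).comp (Primrec.fst.comp
    (Primrec.nat_iterate Primrec.id (Primrec.const _) (hF.comp Primrec.snd).to₂))).to_comp

end CounterMachine

/-! ### A counter machine with long phases -/

namespace CounterMachine

/-- The machine goes from `c` to `c'` in `t` steps, and it shows the bit `b` until then. -/
def Flow (D : CounterMachine) (b : Bool) (c : D.State × (D.ι → ℕ)) (t : ℕ)
    (c' : D.State × (D.ι → ℕ)) : Prop :=
  D.step^[t] c = c' ∧ ∀ j < t, D.bit (D.step^[j] c).1 = b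

theorem Flow.single {D : CounterMachine} {b : Bool} {c c' : D.State × (D.ι → ℕ)}
    (hb : D.bit c.1 = b) (h : D.step c = c') : D.Flow b c 1 c' := by
  refine ⟨h, fun j hj => ?_⟩
  obtain rfl : j = 0 := by omega
  exact hb

theorem Flow.trans {D : CounterMachine} {b : Bool} {c c' c'' : D.State × (D.ι → ℕ)} {t u : ℕ}
    (h : D.Flow b c t c') (h' : D.Flow b c' u c'') : D.Flow b c (t + u) c'' := by
  refine ⟨by rw [add_comm, Function.iterate_add_apply, h.1, h'.1], fun j hj => ?_⟩
  rcases lt_or_ge j t with hjt | hjt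
  · exact h.2 j hjt
  · obtain ⟨i, rfl⟩ := Nat.exists_eq_add_of_le hjt
    rw [add_comm, Function.iterate_add_apply, h.1]
    exact h'.2 i (by omega)

section Phases

open Function

variable {R : Type} [Finite R] [DecidableEq R] (i o : R) (p : WhileProg R) (b₀ : Bool)

/-- The machine that works in phases.  It has a clock, which is the counter `none`, and a counter
for every register of the program `p`.  A phase consists of three modes: in the loading mode
`Sum.inr false`, the clock is emptied into the register `i`; in the running modes `Sum.inl s`, the
program `p` is executed while the clock advances with every step; in the draining mode
`Sum.inr true`, the register `o` is emptied into the clock.  Then the bit is flipped, and the next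
phase begins. -/
def phaseMachine : CounterMachine where
  State := Bool × (p.Point ⊕ Bool)
  ι := Option R
  finState := inferInstance
  finCounters := inferInstance
  start := (b₀, .inr false)
  bit s := s.1
  next
    | (b, .inr false), z =>
      if z none then ((b, .inl p.entry), fun _ => none)
      else ((b, .inr false), fun x => if x = none then some .left
        else if x = some i then some .right else none)
    | (b, .inl s), z =>
      ((b, ((p.next s fun r => z (some r)).1.map Sum.inl).getD (.inr true)),
        fun x => x.elim (some .right) (p.next s fun r => z (some r)).2)
    | (b, .inr true), z =>
      if z (some o) then ((!b, .inr false), fun _ => none)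
      else ((b, .inr true), fun x => if x = none then some .right
        else if x = some o then some .left else none)

/-- The configuration with bit `b`, mode `s`, clock `c` and registers `σ`. -/
def phaseCfg (b : Bool) (s : p.Point ⊕ Bool) (c : ℕ) (σ : R → ℕ) :
    (phaseMachine i o p b₀).State × ((phaseMachine i o p b₀).ι → ℕ) :=
  ((b, s), fun x : Option R => x.elim c σ)

theorem flow_load (b : Bool) (v : ℕ) : (phaseMachine i o p b₀).Flow b
    (phaseCfg i o p b₀ b (.inr false) v fun _ => 0) (v + 1)
    (phaseCfg i o p b₀ b (.inl p.entry) 0 (update (fun _ => 0) i v)) := by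
  suffices h : ∀ c a, (phaseMachine i o p b₀).Flow b
      (phaseCfg i o p b₀ b (.inr false) c (update (fun _ => 0) i a)) (c + 1)
      (phaseCfg i o p b₀ b (.inl p.entry) 0 (update (fun _ => 0) i (a + c))) by
    simpa using h v 0
  intro c
  induction c with
  | zero =>
    refine fun a => .single rfl (Prod.ext ?_ (funext fun x => ?_)) <;>
    simp [phaseCfg, step, phaseMachine, shiftCounter]
  | succ c ih =>
    intro a
    rw [add_comm (c + 1) 1, show a + (c + 1) = (a + 1) + c by omega]
    refine Flow.trans (.single rfl (Prod.ext ?_ (funext fun x => ?_))) (ih (a + 1))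
    · simp [phaseCfg, step, phaseMachine]
    · rcases x with _ | x
      · simp [phaseCfg, step, phaseMachine, shiftCounter]
      · by_cases hx : x = i
        · subst hx; simp [phaseCfg, step, phaseMachine, shiftCounter]
        · simp [phaseCfg, step, phaseMachine, shiftCounter, hx]

theorem step_run (b : Bool) (s : p.Point) (σ : R → ℕ) (c : ℕ) :
    (phaseMachine i o p b₀).step (phaseCfg i o p b₀ b (.inl s) c σ) =
      phaseCfg i o p b₀ b
        (((p.next s fun r => decide (σ r = 0)).1.map Sum.inl).getD (.inr true)) (c + 1)
        fun r => shiftCounter ((p.next s fun r => decide (σ r = 0)).2 r) (σ r) := by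
  refine Prod.ext rfl (funext fun x : Option R => ?_)
  cases x <;> rfl

theorem flow_run (b : Bool) {s : p.Point} {σ τ : R → ℕ} {t : ℕ} (h : p.Run s σ t τ) (c : ℕ) :
    (phaseMachine i o p b₀).Flow b (phaseCfg i o p b₀ b (.inl s) c σ) t
      (phaseCfg i o p b₀ b (.inr true) (c + t) τ) := by
  induction h generalizing c with
  | exit h1 h2 => exact .single rfl (by rw [step_run, h1, h2]; rfl)
  | @cont s s' σ σ' t τ h1 h2 _ ih =>
    rw [add_comm t 1, ← add_assoc]
    exact Flow.trans (.single rfl (by rw [step_run, h1, h2]; rfl)) (ih (c + 1))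

theorem flow_drain (b : Bool) (c v : ℕ) : (phaseMachine i o p b₀).Flow b
    (phaseCfg i o p b₀ b (.inr true) c (update (fun _ => 0) o v)) (v + 1)
    (phaseCfg i o p b₀ (!b) (.inr false) (c + v) fun _ => 0) := by
  induction v generalizing c with
  | zero =>
    refine .single rfl (Prod.ext ?_ (funext fun x => ?_)) <;>
    simp [phaseCfg, step, phaseMachine, shiftCounter]
  | succ v ih =>
    rw [add_comm (v + 1) 1, show c + (v + 1) = (c + 1) + v by omega]
    refine Flow.trans (.single rfl (Prod.ext ?_ (funext fun x => ?_))) (ih (c + 1))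
    · simp [phaseCfg, step, phaseMachine]
    · rcases x with _ | x
      · simp [phaseCfg, step, phaseMachine, shiftCounter]
      · by_cases hx : x = o
        · subst hx; simp [phaseCfg, step, phaseMachine, shiftCounter]
        · simp [phaseCfg, step, phaseMachine, shiftCounter, hx]

/-- Suppose that `p` computes `f`.  A phase that begins with clock value `v` has the duration
`v + t + f v + 2`, where `t` is the number of steps of `p`, and it ends with the clock value
`t + f v`. -/
theorem exists_flow_phase {f : ℕ → ℕ}
    (hp : ∀ v, p.Exec (update (fun _ => 0) i v) (update (fun _ => 0) o (f v)))
    (b : Bool) (v : ℕ) : ∃ t, (phaseMachine i o p b₀).Flow b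
      (phaseCfg i o p b₀ b (.inr false) v fun _ => 0) (v + t + f v + 2)
      (phaseCfg i o p b₀ (!b) (.inr false) (t + f v) fun _ => 0) := by
  obtain ⟨t, ht⟩ := (hp v).exists_run
  refine ⟨t, ?_⟩
  have := ((flow_load i o p b₀ b v).trans (flow_run i o p b₀ b ht 0)).trans
    (flow_drain i o p b₀ b (0 + t) (f v))
  rwa [zero_add, show v + 1 + t + (f v + 1) = v + t + f v + 2 by omega] at this

end Phases

/-- A computable function that bounds `r` on all arguments up to `2 v`, and that is at least
`3 v + 2`.  The first property makes a phase that begins with clock value `v`, at a time of at most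
`2 v`, long enough; the second one preserves the bound `2 v` on the time. -/
theorem exists_computable_bound {r : ℕ → ℕ} (hr : Computable r) :
    ∃ f : ℕ → ℕ, Computable f ∧ ∀ v, 3 * v + 2 ≤ f v ∧ ∀ t ≤ 2 * v, r t ≤ f v := by
  have hle : ∀ n t, t < n → r t ≤ Nat.rec (motive := fun _ => ℕ) 0 (fun y s => s + r y) n := by
    intro n
    induction n with
    | zero => intro t ht; omega
    | succ n ih =>
      intro t ht
      rcases Nat.lt_succ_iff_lt_or_eq.1 ht with h | rfl
      · exact (ih t h).trans (Nat.le_add_right _ _)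
      · exact Nat.le_add_left _ _
  have hmul : ∀ k, Primrec fun v : ℕ => k * v := fun k =>
    Primrec.nat_mul.comp (Primrec.const k) Primrec.id
  refine ⟨fun v => (3 * v + 2) +
    Nat.rec (motive := fun _ => ℕ) 0 (fun y s => s + r y) (2 * v + 1), ?_, fun v => ⟨?_, ?_⟩⟩
  · refine Primrec.nat_add.to_comp.comp
      (Primrec.nat_add.comp (hmul 3) (Primrec.const 2)).to_comp ?_
    exact Computable.nat_rec (f := fun v => 2 * v + 1) (g := fun _ => 0)
      (h := fun _ x => x.2 + r x.1) (Primrec.succ.comp (hmul 2)).to_comp (Computable.const 0)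
      (Primrec.nat_add.to_comp.comp (Computable.snd.comp Computable.snd)
        (hr.comp (Computable.fst.comp Computable.snd))).to₂
  · exact Nat.le_add_right _ _
  · exact fun t ht => (hle (2 * v + 1) t (by omega)).trans (Nat.le_add_left _ _)

/-- For every computable `r` there is a counter machine whose bit starts as `b₀`, where it stays
up to time `r 0`, and takes each value on arbitrarily late intervals of the form `[n, r n]`. -/
theorem exists_out_gaps {r : ℕ → ℕ} (hr : Computable r) (b₀ : Bool) :
    ∃ D : CounterMachine, (∀ j ≤ r 0, D.out j = b₀) ∧
      ∀ b m, ∃ n, m ≤ n ∧ ∀ j, n ≤ j → j ≤ r n → D.out j = b := by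
  obtain ⟨f, hf, hfr⟩ := exists_computable_bound hr
  obtain ⟨R, _, _, i, o, p, hp⟩ := WhileProg.exists_exec_of_computable_finite hf
  let D := phaseMachine i o p b₀
  -- at time `n` a phase with bit `b` and clock value `v` begins; note the bound on the time
  let P : Bool → ℕ → ℕ → Prop := fun b v n =>
    n ≤ 2 * v ∧ D.cfg n = phaseCfg i o p b₀ b (.inr false) v fun _ => 0
  have hphase : ∀ b v n, P b v n → (∀ j, n ≤ j → j ≤ r n → D.out j = b) ∧
      ∃ v' n', n < n' ∧ P (!b) v' n' := by
    rintro b v n ⟨hn, hc⟩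
    obtain ⟨t, ht⟩ := exists_flow_phase i o p b₀ hp b v
    have hadd : ∀ j, D.cfg (n + j) = D.step^[j] (D.cfg n) := fun j => by
      rw [add_comm]; exact Function.iterate_add_apply _ _ _ _
    obtain ⟨h1, h2⟩ := hfr v
    refine ⟨fun j hj hjr => ?_, t + f v, n + (v + t + f v + 2), by omega, by omega, ?_⟩
    · obtain ⟨j, rfl⟩ := Nat.exists_eq_add_of_le hj
      have := h2 n hn
      rw [out, hadd, hc]
      exact ht.2 j (by omega)
    · rw [hadd, hc]
      exact ht.1
  have h0 : P b₀ 0 0 := by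
    refine ⟨le_rfl, Prod.ext rfl (funext fun x : Option R => ?_)⟩
    cases x <;> rfl
  have hlate : ∀ m, ∃ b v n, m ≤ n ∧ P b v n := by
    intro m
    induction m with
    | zero => exact ⟨_, _, _, le_rfl, h0⟩
    | succ m ih =>
      obtain ⟨b, v, n, hmn, h⟩ := ih
      obtain ⟨-, v', n', hn', h'⟩ := hphase b v n h
      exact ⟨_, _, _, by omega, h'⟩
  refine ⟨D, fun j hj => (hphase _ _ _ h0).1 j (Nat.zero_le j) hj, fun b m => ?_⟩
  obtain ⟨b', v, n, hmn, h⟩ := hlate m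
  by_cases hb : b' = b
  · exact ⟨n, hmn, hb ▸ (hphase _ _ _ h).1⟩
  · obtain ⟨-, v', n', hn', h'⟩ := hphase _ _ _ h
    obtain rfl : (!b') = b := by cases b' <;> cases b <;> simp_all
    exact ⟨n', by omega, (hphase _ _ _ h').1⟩

end CounterMachine

/-! ### Tapes -/

/-- The tape has its head on the first of `n` nonblank symbols, with blanks on both sides of these
symbols. -/
structure ShowsBlock (T : Turing.Tape (Option Bool)) (n : ℕ) : Prop where
  left : T.nth (-1) = none
  mid : ∀ i : ℕ, i < n → T.nth i ≠ none
  right : T.nth n = none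

theorem mk₁_nth_nat (l : List (Option Bool)) (i : ℕ) :
    (Turing.Tape.mk₁ l).nth (i : ℤ) = l.getI i := by
  rw [Turing.Tape.mk₁, Turing.Tape.mk₂, Turing.Tape.mk'_nth_nat, Turing.ListBlank.nth_mk]

theorem mk₁_nth_neg_one (l : List (Option Bool)) : (Turing.Tape.mk₁ l).nth (-1) = none := rfl

theorem getI_map_some_append (x : Str) (l : List (Option Bool)) {i : ℕ} (hi : i < x.length) :
    (x.map some ++ l).getI i ≠ none := by
  have h1 : i < (x.map some ++ l).length := by
    simp only [List.length_append, List.length_map]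
    omega
  rw [List.getI_eq_getElem _ h1, List.getElem_append_left (by simpa using hi)]
  simp

theorem showsBlock_inputTape (x : Str) : ShowsBlock (inputTape x) x.length where
  left := mk₁_nth_neg_one _
  mid i hi := by
    rw [inputTape, mk₁_nth_nat]
    simpa using getI_map_some_append x [] hi
  right := by
    rw [inputTape, mk₁_nth_nat, List.getI_eq_default _ (by simp)]
    rfl

theorem showsBlock_inputTape₂ (x y : Str) : ShowsBlock (inputTape₂ x y) x.length where
  left := mk₁_nth_neg_one _
  mid i hi := by
    rw [inputTape₂, mk₁_nth_nat]
    exact getI_map_some_append x _ hi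
  right := by
    rw [inputTape₂, mk₁_nth_nat, List.getI_eq_getElem _ (by simp)]
    simp

/-- The tape that represents the counter value `v`: a blank tape with a marker on one cell, and
the head `v` cells to the right of the marker. -/
def counterTape (v : ℕ) : Turing.Tape (Option Bool) :=
  (Turing.Tape.move .right)^[v] ((Turing.Tape.mk₁ []).write (some true))

theorem counterTape_head (v : ℕ) : (counterTape v).head = if v = 0 then some true else none := by
  rw [counterTape, Turing.Tape.move_right_n_head, Turing.Tape.write_nth]
  by_cases h : v = 0
  · simp [h]
  · rw [if_neg (by exact_mod_cast h), if_neg h, mk₁_nth_nat, List.getI_nil]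
    rfl

/-- On a counter tape, the change of the counter is a movement of the head. -/
theorem moveHead_counterTape (v : ℕ) (d : Option Turing.Dir) :
    moveHead (counterTape v) (if d = some .left ∧ v = 0 then none else d) =
      counterTape (shiftCounter d v) := by
  rcases d with _ | _ | _
  · simp [moveHead, shiftCounter]
  · cases v with
    | zero => simp [moveHead, shiftCounter]
    | succ v =>
      simp [moveHead, shiftCounter, counterTape, Function.iterate_succ_apply',
        -Function.iterate_succ]
  · simp [moveHead, shiftCounter, counterTape, Function.iterate_succ_apply',
      -Function.iterate_succ]

theorem cfg_ext {S ι : Type} {c c' : Cfg S ι} (h : c.state = c'.state)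
    (h' : ∀ i, c.tapes i = c'.tapes i) : c = c' := by
  cases c; cases c'
  obtain rfl : _ = _ := h
  obtain rfl : _ = _ := funext h'
  rfl

/-! ### Branches of probabilistic machines -/

namespace PTM

theorem branches_of_final (M : PTM) {c : Cfg M.State M.ι} (h : c.state ∈ M.final) (t : ℕ) :
    M.branches t c = {c} := by
  cases t <;> simp [branches, h]

theorem branches_succ_of_stop (M : PTM) {c : Cfg M.State M.ι}
    (h : c.state ∈ M.final ∨ M.δ c.state c.read = ∅) (t : ℕ) : M.branches (t + 1) c = {c} :=
  if_pos h

theorem branches_succ_of_not_stop (M : PTM) {c : Cfg M.State M.ι}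
    (h : ¬ (c.state ∈ M.final ∨ M.δ c.state c.read = ∅)) (t : ℕ) :
    M.branches (t + 1) c = (M.δ c.state c.read).val.bind fun a => M.branches t (c.apply a) :=
  if_neg h

theorem branches_succ_of_eq_singleton (M : PTM) {c : Cfg M.State M.ι}
    {a : Action M.State M.ι} (h : c.state ∉ M.final) (ha : M.δ c.state c.read = {a}) (t : ℕ) :
    M.branches (t + 1) c = M.branches t (c.apply a) := by
  simp [branches, h, ha]

/-- Once all branches have halted, more time does not change them. -/
theorem branches_add (M : PTM) {t : ℕ} {c : Cfg M.State M.ι}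
    (h : ∀ c' ∈ M.branches t c, c'.state ∈ M.final) (s : ℕ) :
    M.branches (t + s) c = M.branches t c := by
  induction t generalizing c with
  | zero =>
    rw [zero_add]
    exact M.branches_of_final (h c (by simp [branches])) s
  | succ t ih =>
    rw [add_right_comm]
    by_cases hc : c.state ∈ M.final ∨ M.δ c.state c.read = ∅
    · simp [branches, hc]
    · simp only [branches, if_neg hc] at h ⊢
      refine Multiset.bind_congr fun a ha => ih fun c' hc' => h c' ?_
      exact Multiset.mem_bind.2 ⟨a, ha, hc'⟩

end PTM

theorem countP_eq_of_rel {α β : Type*} {r : α → β → Prop} {p : α → Prop} {q : β → Prop}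
    [DecidablePred p] [DecidablePred q] {s : Multiset α} {t : Multiset β}
    (h : Multiset.Rel r s t) (hpq : ∀ a b, r a b → (p a ↔ q b)) : s.countP p = t.countP q := by
  induction h with
  | zero => simp
  | @cons a b s t hab _ ih =>
    by_cases ha : p a
    · rw [Multiset.countP_cons_of_pos _ ha, Multiset.countP_cons_of_pos _ ((hpq a b hab).1 ha), ih]
    · rw [Multiset.countP_cons_of_neg _ ha,
        Multiset.countP_cons_of_neg _ (mt (hpq a b hab).2 ha), ih]

/-! ### Selecting a machine by the length of the input -/

section Select

variable (D : CounterMachine) (M : Bool → PTM)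

/-- States of the selecting machine: the start state `none`, the states of the sweep to the right
and of the sweep back to the left, and the states of both machines. -/
abbrev SelState : Type := Option (D.State ⊕ Bool) ⊕ (Σ b, (M b).State)

/-- Tapes of the selecting machine: `none` is the common input and output tape. -/
abbrev SelTape : Type := Option ((Σ b, (M b).ι) ⊕ D.ι)

open Classical in
/-- An action of the machine `M b`, as an action of the selecting machine that sees the symbols
`r`.  The input and output tape of `M b` is the common tape `none`.  The tape with the index
`some (.inl ⟨b, (M b).io⟩)` is never read; repeating the action there makes this map injective
without case distinctions. -/
noncomputable def selAction (b : Bool) (r : SelTape D M → Option Bool)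
    (a : Action (M b).State (M b).ι) : Action (SelState D M) (SelTape D M) :=
  (.inr ⟨b, a.1⟩, fun
    | none => a.2 (M b).io
    | some (.inl x) => if h : x.1 = b then a.2 (h ▸ x.2) else (r (some (.inl x)), none)
    | some (.inr i) => (r (some (.inr i)), none))

theorem selAction_injective (b : Bool) (r : SelTape D M → Option Bool) :
    Function.Injective (selAction D M b r) := by
  intro a a' h
  have h1 := congrArg Prod.fst h
  refine Prod.ext (by simpa [selAction] using h1) (funext fun i => ?_)
  simpa [selAction] using congrFun (congrArg Prod.snd h) (some (.inl ⟨b, i⟩))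

/-- The action that goes to state `q` and moves the head on the input tape. -/
def ioAction (r : SelTape D M → Option Bool) (q : SelState D M) (d : Turing.Dir) :
    Action (SelState D M) (SelTape D M) :=
  (q, fun
    | none => (r none, some d)
    | some x => (r (some x), none))

open Classical in
/-- The action of the sweep to the right: move on, and perform a step of the counter machine. -/
noncomputable def sweepAction (r : SelTape D M → Option Bool) (s : D.State) :
    Action (SelState D M) (SelTape D M) :=
  let a := D.next s fun i => decide (r (some (.inr i)) = some true)
  (.inl (some (.inl a.1)), fun
    | none => (r none, some .right)
    | some (.inl x) => (r (some (.inl x)), none)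
    | some (.inr i) => (r (some (.inr i)),
        if a.2 i = some .left ∧ r (some (.inr i)) = some true then none else a.2 i))

open Classical in
/-- The machine that runs `M (D.out n)`, where `n` is the length of the first block of symbols on
the input tape.  It puts the markers on the counter tapes, then sweeps over the block while `D`
performs one step per symbol, and then moves the head back. -/
noncomputable def select : PTM where
  State := SelState D M
  ι := SelTape D M
  finState := by
    have := D.finState
    have := fun b => (M b).finState
    infer_instance
  finTapes := by
    have := D.finCounters
    have := fun b => (M b).finTapes
    infer_instance
  io := none
  start := .inl none
  final := {q | ∃ b s, s ∈ (M b).final ∧ q = .inr ⟨b, s⟩}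
  δ
    | .inl none, r => {(.inl (some (.inl D.start)), fun
        | some (.inr _) => (some true, none)
        | x => (r x, none))}
    | .inl (some (.inl s)), r =>
      if r none = none then {ioAction D M r (.inl (some (.inr (D.bit s)))) .left}
      else {sweepAction D M r s}
    | .inl (some (.inr b)), r =>
      if r none = none then {ioAction D M r (.inr ⟨b, (M b).start⟩) .right}
      else {ioAction D M r (.inl (some (.inr b))) .left}
    | .inr ⟨b, s⟩, r =>
      ((M b).δ s fun i => if i = (M b).io then r none else r (some (.inl ⟨b, i⟩))).map
        ⟨selAction D M b r, selAction_injective D M b r⟩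

/-- The configuration `C` of the selecting machine represents the configuration `c` of `M b`; the
counter tapes, the tapes of the other machine and the unread tape are ignored. -/
structure SelRel (b : Bool) (c : Cfg (M b).State (M b).ι)
    (C : Cfg (select D M).State (select D M).ι) : Prop where
  state : C.state = .inr ⟨b, c.state⟩
  io : C.tapes none = c.tapes (M b).io
  tapes : ∀ i, i ≠ (M b).io → C.tapes (some (.inl ⟨b, i⟩)) = c.tapes i

variable {D M}

theorem SelRel.apply {b : Bool} {c : Cfg (M b).State (M b).ι}
    {C : Cfg (select D M).State (select D M).ι} (h : SelRel D M b c C)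
    (a : Action (M b).State (M b).ι) :
    SelRel D M b (c.apply a) (C.apply (selAction D M b C.read a)) where
  state := rfl
  io := by simp [Cfg.apply, selAction, h.io]
  tapes i hi := by simp [Cfg.apply, selAction, h.tapes i hi]

theorem SelRel.final_iff {b : Bool} {c : Cfg (M b).State (M b).ι}
    {C : Cfg (select D M).State (select D M).ι} (h : SelRel D M b c C) :
    C.state ∈ (select D M).final ↔ c.state ∈ (M b).final := by
  rw [h.state]
  constructor
  · rintro ⟨b', s, hs, e⟩
    cases e
    exact hs
  · exact fun hs => ⟨b, _, hs, rfl⟩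

open Classical in
theorem SelRel.read_eq {b : Bool} {c : Cfg (M b).State (M b).ι}
    {C : Cfg (select D M).State (select D M).ι} (h : SelRel D M b c C) :
    (fun i => if i = (M b).io then C.read none else C.read (some (.inl ⟨b, i⟩))) = c.read := by
  funext i
  by_cases hi : i = (M b).io
  · rw [if_pos hi, hi]
    exact congrArg Turing.Tape.head h.io
  · rw [if_neg hi]
    exact congrArg Turing.Tape.head (h.tapes i hi)

theorem SelRel.δ_eq {b : Bool} {c : Cfg (M b).State (M b).ι}
    {C : Cfg (select D M).State (select D M).ι} (h : SelRel D M b c C) :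
    (select D M).δ C.state C.read = ((M b).δ c.state c.read).map
      ⟨selAction D M b C.read, selAction_injective D M b C.read⟩ := by
  rw [h.state, ← h.read_eq]
  rfl

theorem SelRel.stop_iff {b : Bool} {c : Cfg (M b).State (M b).ι}
    {C : Cfg (select D M).State (select D M).ι} (h : SelRel D M b c C) :
    (C.state ∈ (select D M).final ∨ (select D M).δ C.state C.read = ∅) ↔
      (c.state ∈ (M b).final ∨ (M b).δ c.state c.read = ∅) := by
  rw [h.final_iff, h.δ_eq]
  exact or_congr_right Finset.map_eq_empty

theorem SelRel.branches {b : Bool} {c : Cfg (M b).State (M b).ι}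
    {C : Cfg (select D M).State (select D M).ι} (h : SelRel D M b c C) (t : ℕ) :
    Multiset.Rel (SelRel D M b) ((M b).branches t c) ((select D M).branches t C) := by
  induction t generalizing c C with
  | zero => exact Multiset.Rel.cons h .zero
  | succ t ih =>
    by_cases hc : c.state ∈ (M b).final ∨ (M b).δ c.state c.read = ∅
    · rw [PTM.branches_succ_of_stop _ hc, PTM.branches_succ_of_stop _ (h.stop_iff.2 hc)]
      exact Multiset.Rel.cons h .zero
    · rw [PTM.branches_succ_of_not_stop _ hc,
        PTM.branches_succ_of_not_stop _ (mt h.stop_iff.1 hc), h.δ_eq]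
      erw [Finset.map_val, Multiset.bind_map]
      refine Multiset.rel_bind (r := Eq) ?_ (Multiset.rel_eq.2 rfl)
      rintro a _ rfl
      exact ih (h.apply a)

variable (D M)

/-- A configuration during the sweeps, with input tape `T` and counter values `σ`. -/
def sweepCfg (q : D.State ⊕ Bool) (T : Turing.Tape (Option Bool)) (σ : D.ι → ℕ) :
    Cfg (select D M).State (select D M).ι where
  state := Sum.inl (some q)
  tapes := fun x : SelTape D M => match x with
    | none => T
    | some (.inl _) => Turing.Tape.mk₁ []
    | some (.inr i) => counterTape (σ i)

theorem sweep_notMem_final (q : Option (D.State ⊕ Bool)) :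
    (Sum.inl q : SelState D M) ∉ (select D M).final := by
  rintro ⟨b, s, -, h⟩
  cases h

theorem branches_init (T : Turing.Tape (Option Bool)) (t : ℕ) :
    (select D M).branches (t + 1) ((select D M).init T) =
      (select D M).branches t (sweepCfg D M (.inl D.start) T fun _ => 0) := by
  rw [PTM.branches_succ_of_eq_singleton _ (sweep_notMem_final D M none) rfl]
  congr 1
  refine cfg_ext rfl fun x : SelTape D M => ?_
  rcases x with _ | x | i
  · exact (Turing.Tape.write_self _).trans (if_pos rfl)
  · exact (Turing.Tape.write_self _).trans (if_neg (Option.some_ne_none _))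
  · exact congrArg (Turing.Tape.write (some true)) (if_neg (Option.some_ne_none _))

theorem branches_sweep_right {T : Turing.Tape (Option Bool)} (hT : T.head ≠ none)
    (c : D.State × (D.ι → ℕ)) (t : ℕ) :
    (select D M).branches (t + 1) (sweepCfg D M (.inl c.1) T c.2) =
      (select D M).branches t
        (sweepCfg D M (.inl (D.step c).1) (T.move .right) (D.step c).2) := by
  have hz : (fun i => decide ((counterTape (c.2 i)).head = some true)) =
      fun i => decide (c.2 i = 0) := by
    funext i
    rw [counterTape_head]
    by_cases h : c.2 i = 0 <;> simp [h]
  rw [PTM.branches_succ_of_eq_singleton _ (sweep_notMem_final D M _) (if_neg hT)]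
  congr 1
  refine cfg_ext ?_ fun x : SelTape D M => ?_
  · exact congrArg (fun z => Sum.inl (some (Sum.inl (D.next c.1 z).1))) hz
  · rcases x with _ | x | i
    · exact congrArg (Turing.Tape.move .right) (Turing.Tape.write_self T)
    · exact Turing.Tape.write_self _
    · have hm := moveHead_counterTape (c.2 i) ((D.next c.1 fun i => decide (c.2 i = 0)).2 i)
      have hi : (counterTape (c.2 i)).head = some true ↔ c.2 i = 0 := by
        simpa using congrFun hz i
      rw [← hz] at hm
      simp only [← hi] at hm
      refine Eq.trans ?_ (hm.trans ?_)
      · exact congrArg (moveHead · _) (Turing.Tape.write_self _)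
      · rw [hz]
        rfl

theorem branches_turn {T : Turing.Tape (Option Bool)} (hT : T.head = none)
    (s : D.State) (σ : D.ι → ℕ) (t : ℕ) :
    (select D M).branches (t + 1) (sweepCfg D M (.inl s) T σ) =
      (select D M).branches t (sweepCfg D M (.inr (D.bit s)) (T.move .left) σ) := by
  rw [PTM.branches_succ_of_eq_singleton _ (sweep_notMem_final D M _) (if_pos hT)]
  congr 1
  refine cfg_ext rfl fun x : SelTape D M => ?_
  rcases x with _ | x | i
  · exact congrArg (Turing.Tape.move .left) (Turing.Tape.write_self T)
  · exact Turing.Tape.write_self _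
  · exact Turing.Tape.write_self _

theorem branches_sweep_left {T : Turing.Tape (Option Bool)} (hT : T.head ≠ none)
    (b : Bool) (σ : D.ι → ℕ) (t : ℕ) :
    (select D M).branches (t + 1) (sweepCfg D M (.inr b) T σ) =
      (select D M).branches t (sweepCfg D M (.inr b) (T.move .left) σ) := by
  rw [PTM.branches_succ_of_eq_singleton _ (sweep_notMem_final D M _) (if_neg hT)]
  congr 1
  refine cfg_ext rfl fun x : SelTape D M => ?_
  rcases x with _ | x | i
  · exact congrArg (Turing.Tape.move .left) (Turing.Tape.write_self T)
  · exact Turing.Tape.write_self _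
  · exact Turing.Tape.write_self _

theorem exists_branches_start {T : Turing.Tape (Option Bool)} (hT : T.head = none)
    (b : Bool) (σ : D.ι → ℕ) : ∃ C, SelRel D M b ((M b).init (T.move .right)) C ∧
      ∀ t, (select D M).branches (t + 1) (sweepCfg D M (.inr b) T σ) =
        (select D M).branches t C := by
  refine ⟨_, ⟨?_, ?_, fun i hi => ?_⟩, fun t =>
    PTM.branches_succ_of_eq_singleton _ (sweep_notMem_final D M _) (if_pos hT) t⟩
  · rfl
  · simp only [PTM.init, if_true]
    exact congrArg (Turing.Tape.move .right) (Turing.Tape.write_self T)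
  · simp only [PTM.init, if_neg hi]
    exact Turing.Tape.write_self _

theorem branches_sweep_right_iterate {T : Turing.Tape (Option Bool)} {n : ℕ}
    (hT : ShowsBlock T n) (j : ℕ) (hj : j ≤ n) (t : ℕ) :
    (select D M).branches (t + j) (sweepCfg D M (.inl D.start) T fun _ => 0) =
      (select D M).branches t
        (sweepCfg D M (.inl (D.cfg j).1) ((Turing.Tape.move .right)^[j] T) (D.cfg j).2) := by
  induction j generalizing t with
  | zero => rfl
  | succ j ih =>
    rw [show t + (j + 1) = (t + 1) + j by omega, ih (by omega), branches_sweep_right,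
      ← D.cfg_succ, Function.iterate_succ_apply']
    rw [Turing.Tape.move_right_n_head]
    exact hT.mid j hj

/-- The sweep back to the left, from any position within the block, ends in the initial
configuration of the machine `M b`. -/
theorem exists_branches_sweep_left {T : Turing.Tape (Option Bool)} {n : ℕ}
    (hT : ShowsBlock T n) (b : Bool) (σ : D.ι → ℕ) :
    ∃ C, SelRel D M b ((M b).init T) C ∧ ∀ j ≤ n, ∀ t, (select D M).branches (t + (j + 1))
      (sweepCfg D M (.inr b) (((Turing.Tape.move .right)^[j] T).move .left) σ) =
        (select D M).branches t C := by
  have h0 : (T.move .left).head = none := by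
    rw [← Turing.Tape.nth_zero, Turing.Tape.move_left_nth]
    exact hT.left
  obtain ⟨C, hC, h⟩ := exists_branches_start D M h0 b σ
  rw [Turing.Tape.move_left_right] at hC
  refine ⟨C, hC, fun j => ?_⟩
  induction j with
  | zero => exact fun _ t => h t
  | succ j ih =>
    intro hj t
    rw [Function.iterate_succ_apply', Turing.Tape.move_right_left, ← add_assoc,
      branches_sweep_left]
    · exact ih (by omega) t
    · rw [Turing.Tape.move_right_n_head]
      exact hT.mid j hj

/-- After `2 n + 3` steps, the selecting machine has come to the initial configuration of the
machine selected by the length `n` of the first block on the input tape. -/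
theorem exists_branches_select {T : Turing.Tape (Option Bool)} {n : ℕ} (hT : ShowsBlock T n) :
    ∃ C, SelRel D M (D.out n) ((M (D.out n)).init T) C ∧
      ∀ t, (select D M).branches (t + (2 * n + 3)) ((select D M).init T) =
        (select D M).branches t C := by
  obtain ⟨C, hC, h⟩ := exists_branches_sweep_left D M hT (D.out n) (D.cfg n).2
  refine ⟨C, hC, fun t => ?_⟩
  rw [← h n le_rfl t, show t + (2 * n + 3) = (((t + (n + 1)) + 1) + n) + 1 by omega,
    branches_init, branches_sweep_right_iterate D M hT n le_rfl, branches_turn]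
  · rfl
  · rw [Turing.Tape.move_right_n_head]
    exact hT.right

/-- On an input whose first block has length `n`, the branches of the selecting machine are those
of `M (D.out n)`. -/
theorem rel_branches_select {T : Turing.Tape (Option Bool)} {n : ℕ} (hT : ShowsBlock T n)
    {t t' : ℕ} (ht : (M (D.out n)).HaltsWithin T t) (htt' : t + (2 * n + 3) ≤ t') :
    Multiset.Rel (SelRel D M (D.out n)) ((M (D.out n)).branches t ((M (D.out n)).init T))
      ((select D M).branches t' ((select D M).init T)) := by
  obtain ⟨C, hC, h⟩ := exists_branches_select D M hT
  obtain ⟨s, rfl⟩ := Nat.exists_eq_add_of_le htt'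
  rw [show t + (2 * n + 3) + s = (t + s) + (2 * n + 3) by omega, h,
    ← PTM.branches_add _ ht s]
  exact hC.branches _

theorem select_haltsWithin {T : Turing.Tape (Option Bool)} {n : ℕ} (hT : ShowsBlock T n)
    {t t' : ℕ} (ht : (M (D.out n)).HaltsWithin T t) (htt' : t + (2 * n + 3) ≤ t') :
    (select D M).HaltsWithin T t' := by
  have h := rel_branches_select D M hT ht htt'
  intro C hC
  obtain ⟨c, hc, hcC⟩ := Multiset.exists_mem_of_rel_of_mem (Multiset.rel_flip.2 h) hC
  exact (SelRel.final_iff hcC).2 (ht c hc)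

open Classical in
theorem select_acceptProb {T : Turing.Tape (Option Bool)} {n : ℕ} (hT : ShowsBlock T n)
    {t t' : ℕ} (ht : (M (D.out n)).HaltsWithin T t) (htt' : t + (2 * n + 3) ≤ t') :
    (select D M).acceptProb T t' = (M (D.out n)).acceptProb T t := by
  have h := rel_branches_select D M hT ht htt'
  rw [PTM.acceptProb, PTM.acceptProb, ← Multiset.card_eq_card_of_rel h]
  congr 2
  refine (countP_eq_of_rel h fun c C hcC => ?_).symm
  rw [SelRel.final_iff hcC, ← hcC.io]
  rfl

end Select

/-! ### Deterministic machines -/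

namespace DTM

/-- A deterministic machine as a probabilistic one. -/
def toPTM (M : DTM) : PTM where
  State := M.State
  ι := M.ι
  finState := M.finState
  finTapes := M.finTapes
  io := M.io
  start := M.start
  final := M.final
  δ := fun s r => {M.δ s r}

theorem branches_toPTM (M : DTM) (t : ℕ) (c : Cfg M.State M.ι) :
    M.toPTM.branches t c = {M.step^[t] c} := by
  induction t generalizing c with
  | zero => rfl
  | succ t ih =>
    by_cases h : c.state ∈ M.final
    · have hs : M.step c = c := if_pos h
      rw [Function.iterate_fixed hs]
      exact M.toPTM.branches_of_final h _
    · rw [M.toPTM.branches_succ_of_eq_singleton h rfl, Function.iterate_succ_apply]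
      have hs : M.step c = c.apply (M.δ c.state c.read) := if_neg h
      rw [hs]
      exact ih _

end DTM

/-- The deterministic machine that performs the only possible action of `P`. -/
noncomputable def PTM.toDTM (P : PTM) (h : ∀ s r, ∃ a, P.δ s r = {a}) : DTM where
  State := P.State
  ι := P.ι
  finState := P.finState
  finTapes := P.finTapes
  io := P.io
  start := P.start
  final := P.final
  δ := fun s r => (h s r).choose

theorem PTM.toPTM_toDTM (P : PTM) (h : ∀ s r, ∃ a, P.δ s r = {a}) : (P.toDTM h).toPTM = P := by
  have : (fun s r => {(h s r).choose}) = P.δ :=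
    funext fun s => funext fun r => (h s r).choose_spec.symm
  cases P
  simp only [DTM.toPTM, PTM.toDTM]
  congr

theorem select_toPTM_δ (D : CounterMachine) (M : Bool → DTM)
    (s : (select D fun b => (M b).toPTM).State) (r) :
    ∃ a, (select D fun b => (M b).toPTM).δ s r = {a} := by
  rcases s with (_ | s | b) | ⟨b, s⟩
  · exact ⟨_, rfl⟩
  · by_cases h : r none = none
    · exact ⟨_, if_pos h⟩
    · exact ⟨_, if_neg h⟩
  · by_cases h : r none = none
    · exact ⟨_, if_pos h⟩
    · exact ⟨_, if_neg h⟩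
  · exact ⟨_, Finset.map_singleton _ _⟩

/-- A machine outputs `w` if all its branches do, in the probabilistic reading. -/
theorem outputsWithin_iff (M : DTM) (x : Str) (t : ℕ) (w : Str) : M.OutputsWithin x t w ↔
    ∀ c ∈ M.toPTM.branches t (M.toPTM.init (inputTape x)),
      c.state ∈ M.toPTM.final ∧ TapeShows (c.tapes M.toPTM.io) w := by
  have : ∀ c, c ∈ M.toPTM.branches t (M.toPTM.init (inputTape x)) ↔
      c = M.step^[t] (M.init (inputTape x)) := fun c => by
    rw [show M.toPTM.branches t (M.toPTM.init (inputTape x)) =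
      {M.step^[t] (M.init (inputTape x))} from M.branches_toPTM t _]
    exact Multiset.mem_singleton
  refine ⟨fun h c hc => (this c).1 hc ▸ h, fun h => h _ ((this _).2 rfl)⟩

/-- The time bound of the selecting machine. -/
theorem exists_select_bound (p : Bool → Polynomial ℕ) :
    ∃ q : Polynomial ℕ, ∀ b n, ∀ m ≤ n, (p b).eval n + (2 * m + 3) ≤ q.eval n := by
  refine ⟨p false + p true + (2 * Polynomial.X + 3), fun b n m hm => ?_⟩
  have : (3 : Polynomial ℕ).eval n = 3 := by simp
  have h2 : (2 : Polynomial ℕ).eval n = 2 := by simp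
  simp only [Polynomial.eval_add, Polynomial.eval_mul, Polynomial.eval_X, this, h2]
  cases b <;> omega

theorem PolyTimeComputable.select {f : Bool → Str → Str} (hf : ∀ b, PolyTimeComputable (f b))
    (D : CounterMachine) : PolyTimeComputable fun x => f (D.out x.length) x := by
  choose M p hM using hf
  obtain ⟨q, hq⟩ := exists_select_bound p
  refine ⟨(UDT.select D fun b => (M b).toPTM).toDTM (select_toPTM_δ D M), q, fun x => ?_⟩
  rw [outputsWithin_iff, PTM.toPTM_toDTM]
  have h := (outputsWithin_iff _ _ _ _).1 (hM (D.out x.length) x)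
  have hrel := rel_branches_select D (fun b => (M b).toPTM)
    (showsBlock_inputTape x) (fun c hc => (h c hc).1) (hq (D.out x.length) x.length _ le_rfl)
  intro C hC
  obtain ⟨c, hc, hcC⟩ := Multiset.exists_mem_of_rel_of_mem (Multiset.rel_flip.2 hrel) hC
  exact ⟨(SelRel.final_iff hcC).2 (h c hc).1, hcC.io ▸ (h c hc).2⟩

/-- Prefixing a bit: move the head to the left and write the bit. -/
theorem polyTimeComputable_cons (b : Bool) : PolyTimeComputable (List.cons b) := by
  let M : DTM :=
    { State := Fin 3
      ι := Unit
      finState := inferInstance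
      finTapes := inferInstance
      io := ()
      start := 0
      final := {2}
      δ := fun s r => if s = 0 then (1, fun i => (r i, some .left))
        else (2, fun _ => (some b, none)) }
  refine ⟨M, 2, fun x => ?_⟩
  have h2 : (2 : Polynomial ℕ).eval x.length = 2 := by simp
  rw [h2]
  have hstep : M.step^[2] (M.init (inputTape x)) =
      ⟨(2 : Fin 3), fun _ : Unit => ((inputTape x).move .left).write (some b)⟩ := by
    have hnf₀ : (0 : Fin 3) ∉ M.final := by simp [M]
    have hnf₁ : (1 : Fin 3) ∉ M.final := by simp [M]
    have h1 : M.step (M.init (inputTape x)) =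
        ⟨(1 : Fin 3), fun _ : Unit => (inputTape x).move .left⟩ := by
      refine (if_neg hnf₀).trans (cfg_ext rfl fun i => ?_)
      exact congrArg (Turing.Tape.move .left) ((Turing.Tape.write_self _).trans (if_pos rfl))
    rw [Function.iterate_succ_apply, Function.iterate_one, h1]
    exact if_neg hnf₁
  rw [DTM.OutputsWithin, hstep]
  refine ⟨rfl, fun i hi => ?_⟩
  simp only [Turing.Tape.write_nth]
  cases i with
  | zero => simp
  | succ i =>
    rw [if_neg (by omega), Turing.Tape.move_left_nth,
      show ((i + 1 : ℕ) : ℤ) - 1 = i by push_cast; ring, inputTape, mk₁_nth_nat,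
      List.getElem?_cons_succ]
    rcases lt_or_ge i x.length with h | h
    · rw [List.getI_eq_getElem _ (by simpa using h), List.getElem?_eq_getElem h]
      simp
    · rw [List.getI_eq_default _ (by simpa using h), List.getElem?_eq_none h]
      rfl

theorem IsPoly.select {f : Bool → ℕ → ℕ} (hf : ∀ b, IsPoly (f b)) (D : CounterMachine) :
    IsPoly fun n => f (D.out n) n := by
  refine ⟨?_, PolyTimeComputable.select (fun b => (hf b).2) D⟩
  choose p hp using fun b => (hf b).1
  refine ⟨p false + p true, fun n => ?_⟩
  rw [Polynomial.eval_add]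
  have := hp (D.out n) n
  dsimp only
  generalize D.out n = b at this ⊢
  cases b <;> omega

/-! ### Selecting behaviours -/

theorem IsVerifierFamily.select {out : Bool → Str → Str} (h : ∀ b, IsVerifierFamily (out b))
    (D : CounterMachine) : IsVerifierFamily fun x => out (D.out x.length) x := by
  refine ⟨PolyTimeComputable.select (fun b => (h b).1) D, ?_⟩
  choose k m hm hkm hc using fun b => (h b).2
  exact ⟨fun n => k (D.out n) n, fun n => m (D.out n) n, IsPoly.select hm D, IsPoly.select hkm D,
    fun x c hx => hc _ x c hx⟩

/-- The behaviours of a class are closed under selection by the length of the input. -/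
theorem BaseClass.select_mem_behaviours (B : BaseClass) {V : Bool → Behaviour}
    (hV : ∀ b, V b ∈ B.behaviours) (D : CounterMachine) :
    (fun x => V (D.out x.length) x) ∈ B.behaviours := by
  cases B with
  | promiseBPP =>
    choose M p hM hVM using hV
    obtain ⟨q, hq⟩ := exists_select_bound p
    refine ⟨UDT.select D M, q, fun x => ?_, fun x => ?_⟩
    · exact select_haltsWithin D M (showsBlock_inputTape x) (hM _ x) (hq _ _ _ le_rfl)
    · dsimp only
      rw [hVM, select_acceptProb D M (showsBlock_inputTape x) (hM _ x) (hq _ _ _ le_rfl)]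
  | promiseMA =>
    choose M p m hm hM hVM using hV
    obtain ⟨q, hq⟩ := exists_select_bound p
    refine ⟨UDT.select D M, q, fun n => m (D.out n) n, IsPoly.select hm D, fun x y => ?_,
      fun x => ?_⟩
    · exact select_haltsWithin D M (showsBlock_inputTape₂ x y) (hM _ x y)
        (hq _ _ _ (Nat.le_add_right _ _))
    · dsimp only
      rw [hVM]
      ext v
      refine exists_congr fun y => and_congr_right fun _ => ?_
      rw [select_acceptProb D M (showsBlock_inputTape₂ x y) (hM _ x y)
        (hq _ _ _ (Nat.le_add_right _ _))]
  | BQP =>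
    choose out hout h0 hVo using hV
    exact ⟨fun x => out (D.out x.length) x, PolyTimeComputable.select hout D,
      fun x c hc => h0 _ x c hc, fun x => hVo _ x⟩
  | QCMA =>
    choose out hout hVo using hV
    exact ⟨fun x => out (D.out x.length) x, IsVerifierFamily.select hout D, fun x => hVo _ x⟩
  | QMA =>
    choose out hout hVo using hV
    exact ⟨fun x => out (D.out x.length) x, IsVerifierFamily.select hout D, fun x => hVo _ x⟩

/-! ### Diagonalization against recursively presentable classes -/

namespace PromiseProblem

open Classical in
/-- The answer of a program that totally decides `A`. -/
noncomputable def val (A : PromiseProblem) (x : Str) : Str :=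
  if x ∈ A.yes then [true] else if x ∈ A.no then [false] else [true, false]

theorem notMem_no_of_mem_yes (A : PromiseProblem) {x : Str} (h : x ∈ A.yes) : x ∉ A.no :=
  fun h' => (Set.ext_iff.1 A.disj x).1 ⟨h, h'⟩

theorem val_eq_yes {A : PromiseProblem} {x : Str} : A.val x = [true] ↔ x ∈ A.yes := by
  by_cases h : x ∈ A.yes
  · simp [val, h]
  · by_cases h' : x ∈ A.no <;> simp [val, h, h']

theorem val_eq_no {A : PromiseProblem} {x : Str} : A.val x = [false] ↔ x ∈ A.no := by
  by_cases h : x ∈ A.yes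
  · simp [val, h, A.notMem_no_of_mem_yes h]
  · by_cases h' : x ∈ A.no <;> simp [val, h, h']

theorem val_eq_other {A : PromiseProblem} {x : Str} : A.val x = [true, false] ↔ x ∉ A.promise := by
  by_cases h : x ∈ A.yes
  · simp [val, h, promise]
  · by_cases h' : x ∈ A.no <;> simp [val, h, h', promise]

theorem val_cases (A : PromiseProblem) (x : Str) :
    A.val x = [true] ∨ A.val x = [false] ∨ A.val x = [true, false] := by
  by_cases h : x ∈ A.yes
  · exact .inl (val_eq_yes.2 h)
  · by_cases h' : x ∈ A.no
    · exact .inr (.inl (val_eq_no.2 h'))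
    · exact .inr (.inr (val_eq_other.2 (by simp [promise, h, h'])))

theorem val_ne_of_mem_diff {A B : PromiseProblem} {x : Str} (h : x ∈ A.diff B) :
    A.val x ≠ [true, false] ∧ A.val x ≠ B.val x := by
  rcases h with ⟨h, h'⟩ | ⟨h, h'⟩
  · rw [val_eq_yes.2 h]
    exact ⟨by simp, fun e => h' (val_eq_yes.1 e.symm)⟩
  · rw [val_eq_no.2 h]
    exact ⟨by simp, fun e => h' (val_eq_no.1 e.symm)⟩

theorem isDecision_iff {A : PromiseProblem} : A.IsDecision ↔ ∀ x, A.val x ≠ [true, false] := by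
  simp [IsDecision, Set.eq_univ_iff_forall, val_eq_other]

theorem IsSubproblem.val_eq {A B : PromiseProblem} (h : A.IsSubproblem B) {x : Str}
    (hx : A.val x ≠ [true, false]) : B.val x = A.val x := by
  rcases A.val_cases x with e | e | e
  · rw [e, val_eq_yes]; exact h.1 (val_eq_yes.1 e)
  · rw [e, val_eq_no]; exact h.2 (val_eq_no.1 e)
  · exact absurd e hx

end PromiseProblem

theorem totallyDecides_iff {c : Nat.Partrec.Code} {A : PromiseProblem} :
    TotallyDecides c A ↔ ∀ x, Returns c x (A.val x) := by
  constructor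
  · rintro ⟨h1, h2, h3⟩ x
    rcases A.val_cases x with e | e | e
    · rw [e]; exact h1 x (PromiseProblem.val_eq_yes.1 e)
    · rw [e]; exact h2 x (PromiseProblem.val_eq_no.1 e)
    · rw [e]; exact h3 x (PromiseProblem.val_eq_other.1 e)
  · refine fun h => ⟨fun x hx => ?_, fun x hx => ?_, fun x hx => ?_⟩
    · exact PromiseProblem.val_eq_yes.2 hx ▸ h x
    · exact PromiseProblem.val_eq_no.2 hx ▸ h x
    · exact PromiseProblem.val_eq_other.2 hx ▸ h x

theorem totallyDecidable_iff {A : PromiseProblem} : TotallyDecidable A ↔ Computable A.val := by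
  constructor
  · rintro ⟨c, hc⟩
    rw [totallyDecides_iff] at hc
    have h1 : Partrec fun x : Str => c.eval (Encodable.encode x) :=
      Nat.Partrec.Code.eval_part.comp (Computable.const c) Computable.encode
    have h2 : Computable fun x => Encodable.encode (A.val x) :=
      h1.of_eq fun x => Part.eq_some_iff.2 (hc x)
    exact Computable.encode_iff.1 h2
  · intro h
    obtain ⟨c, hc⟩ := Nat.Partrec.Code.exists_code.1 h
    refine ⟨c, totallyDecides_iff.2 fun x => ?_⟩
    rw [Returns, hc]
    simp

/-- The number `v` is the code of one of the three answers `1`, `0`, `10` of a deciding program. -/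
def IsAnswerCode (v : ℕ) : Prop :=
  v = Encodable.encode [true] ∨ v = Encodable.encode [false] ∨ v = Encodable.encode [true, false]

/-- A program all of whose answers are proper totally decides some problem. -/
theorem exists_totallyDecides {c : Nat.Partrec.Code} {e : Str → ℕ}
    (he : ∀ x, e x ∈ c.eval (Encodable.encode x)) (h : ∀ x, IsAnswerCode (e x)) :
    ∃ A, TotallyDecides c A := by
  refine ⟨⟨{x | e x = Encodable.encode [true]}, {x | e x = Encodable.encode [false]}, ?_⟩,
    fun x hx => ?_, fun x hx => ?_, fun x hx => ?_⟩
  · ext x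
    simp only [Set.mem_inter_iff, Set.mem_ofPred_eq, Set.mem_empty_iff_false, iff_false, not_and]
    intro h1 h2
    simpa using Encodable.encode_injective (h1.symm.trans h2)
  · have := he x
    rwa [show e x = _ from hx] at this
  · have := he x
    rwa [show e x = _ from hx] at this
  · have hx' := he x
    rcases h x with h1 | h1 | h1
    · exact absurd (Or.inl h1) hx
    · exact absurd (Or.inr h1) hx
    · rwa [h1] at hx'

/-- Unbounded search for strings, with a common bound for the first searches. -/
theorem exists_search_bound {Q : ℕ × ℕ → Str → Bool} (hQ : Computable₂ Q) (h : ∀ p, ∃ x, Q p x) :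
    ∃ r : ℕ → ℕ, Computable r ∧ ∀ n, ∀ i ≤ n, ∃ x : Str, x.length ≤ r n ∧ Q (i, n) x := by
  -- the length is tested since `k` need not be the code of the string it decodes to
  let P : ℕ × ℕ → ℕ → Bool := fun p k =>
    Option.casesOn (motive := fun _ => Bool) (Encodable.decode (α := Str) k) false fun x => decide (x.length ≤ k) && Q p x
  have hP : Computable₂ P :=
    (Computable.option_casesOn (o := fun a : (ℕ × ℕ) × ℕ => Encodable.decode (α := Str) a.2)
      (f := fun _ => false) (g := fun a x => decide (x.length ≤ a.2) && Q a.1 x)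
      (Computable.decode.comp Computable.snd) (Computable.const false)
      (Primrec.and.to_comp.comp (Primrec.nat_le.decide.to_comp.comp
        (Computable.list_length.comp Computable.snd) (Computable.snd.comp Computable.fst))
        (hQ.comp (Computable.fst.comp Computable.fst) Computable.snd)).to₂).to₂
  have hex : ∀ p, ∃ k, P p k = true := fun p => by
    obtain ⟨x, hx⟩ := h p
    exact ⟨Encodable.encode x, by simpa [P, Encodable.length_le_encode] using hx⟩
  have hg : Computable fun p : ℕ × ℕ => Nat.find (hex p) := by
    have h1 : Partrec fun p => Nat.rfind fun k => Part.some (P p k) := Partrec.rfind hP.partrec₂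
    refine h1.of_eq fun p => Part.eq_some_iff.2 (Nat.mem_rfind.2 ⟨?_, fun {m} hm => ?_⟩)
    · simpa using Nat.find_spec (hex p)
    · simpa using Nat.find_min (hex p) hm
  let g : ℕ × ℕ → ℕ := fun p => Nat.find (hex p)
  have hle : ∀ n m i, i < m →
      g (i, n) ≤ Nat.rec (motive := fun _ => ℕ) 0 (fun y s => s + g (y, n)) m := by
    intro n m
    induction m with
    | zero => intro i hi; omega
    | succ m ih =>
      intro i hi
      rcases Nat.lt_succ_iff_lt_or_eq.1 hi with h | rfl
      · exact (ih i h).trans (Nat.le_add_right _ _)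
      · exact Nat.le_add_left _ _
  refine ⟨fun n => Nat.rec (motive := fun _ => ℕ) 0 (fun y s => s + g (y, n)) (n + 1), ?_, ?_⟩
  · exact Computable.nat_rec (f := fun n => n + 1) (g := fun _ => 0)
      (h := fun n x => x.2 + g (x.1, n)) Computable.succ (Computable.const 0)
      (Primrec.nat_add.to_comp.comp (Computable.snd.comp Computable.snd)
        (hg.comp ((Computable.fst.comp Computable.snd).pair Computable.fst))).to₂
  · intro n i hi
    have h1 : P (i, n) (g (i, n)) = true := Nat.find_spec (hex (i, n))
    cases hd : Encodable.decode (α := Str) (g (i, n)) with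
    | none => simp [P, hd] at h1
    | some x =>
      rw [show P (i, n) (g (i, n)) = (decide (x.length ≤ g (i, n)) && Q (i, n) x) by
        simp only [P, hd], Bool.and_eq_true, decide_eq_true_eq] at h1
      exact ⟨x, h1.1.trans (hle n (n + 1) i (by omega)), h1.2⟩

/-- Consider a computable series of total programs with answers `e i x`.  If each of them gives an
improper answer somewhere or differs from `a` on arbitrarily long strings in `w`, then one
computable function bounds where this happens. -/
theorem exists_disagreement_bound {e : ℕ → Str → ℕ} (he : Computable₂ e) {a : Str → ℕ}
    (ha : Computable a) {w : Str → Bool} (hw : Computable w)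
    (h : ∀ i, (∀ x, IsAnswerCode (e i x)) → ∀ n, ∃ x, n ≤ x.length ∧ w x = true ∧ e i x ≠ a x) :
    ∃ r : ℕ → ℕ, Computable r ∧ ∀ n, ∀ i ≤ n, (∀ x, IsAnswerCode (e i x)) →
      ∃ x : Str, n ≤ x.length ∧ x.length ≤ r n ∧ w x = true ∧ e i x ≠ a x := by
  have hans : PrimrecPred IsAnswerCode :=
    (Primrec.eq.comp Primrec.id (Primrec.const _)).or
      ((Primrec.eq.comp Primrec.id (Primrec.const _)).or
        (Primrec.eq.comp Primrec.id (Primrec.const _)))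
  obtain ⟨_, hans⟩ := hans
  -- improper answers are searched for among all strings, since there may be only short ones
  let Q : ℕ × ℕ → Str → Bool := fun p x => !decide (IsAnswerCode (e p.1 x)) ||
    (decide (p.2 ≤ x.length) && (w x && !decide (e p.1 x = a x)))
  have hQ : ∀ p x, Q p x = true ↔ ¬ IsAnswerCode (e p.1 x) ∨
      (p.2 ≤ x.length ∧ w x = true ∧ e p.1 x ≠ a x) := by
    intro p x
    simp [Q]
  have hQc : Computable₂ Q := by
    have he' : Computable fun p : (ℕ × ℕ) × Str => e p.1.1 p.2 :=
      he.comp (Computable.fst.comp Computable.fst) Computable.snd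
    exact (Primrec.or.to_comp.comp (Primrec.not.to_comp.comp (hans.to_comp.comp he'))
      (Primrec.and.to_comp.comp
        (Primrec.nat_le.decide.to_comp.comp (Computable.snd.comp Computable.fst)
          (Computable.list_length.comp Computable.snd))
        (Primrec.and.to_comp.comp (hw.comp Computable.snd)
          (Primrec.not.to_comp.comp
            (Primrec.eq.decide.to_comp.comp he' (ha.comp Computable.snd)))))).to₂
  obtain ⟨r, hr, hrQ⟩ := exists_search_bound hQc fun p => by
    by_cases hp : ∀ x, IsAnswerCode (e p.1 x)
    · obtain ⟨x, hx⟩ := h p.1 hp p.2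
      exact ⟨x, (hQ p x).2 (.inr hx)⟩
    · obtain ⟨x, hx⟩ := not_forall.1 hp
      exact ⟨x, (hQ p x).2 (.inl hx)⟩
  refine ⟨r, hr, fun n i hi hp => ?_⟩
  obtain ⟨x, hx, hQx⟩ := hrQ n i hi
  rcases (hQ _ _).1 hQx with h1 | ⟨h1, h2, h3⟩
  · exact absurd (hp x) h1
  · exact ⟨x, h1, hx, h2, h3⟩

/-- The answers of a computable series of programs that halt on all inputs. -/
theorem exists_answers {M : ℕ → Nat.Partrec.Code} (hM : Computable M)
    (hh : ∀ i x, HaltsOn (M i) x) : ∃ e : ℕ → Str → ℕ, Computable₂ e ∧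
      ∀ i x, e i x ∈ (M i).eval (Encodable.encode x) := by
  refine ⟨fun i x => ((M i).eval (Encodable.encode x)).get (hh i x), ?_, fun i x => Part.get_mem _⟩
  have h1 : Partrec fun p : ℕ × Str => (M p.1).eval (Encodable.encode p.2) :=
    Nat.Partrec.Code.eval_part.comp (hM.comp Computable.fst)
      (Computable.encode.comp Computable.snd)
  exact h1.of_eq fun p => Part.eq_some_iff.2 (Part.get_mem _)

/-- `B` agrees with `A` on all strings of the lengths between `n` and `r n`, for infinitely
many `n`. -/
def AgreesOnGaps (A B : PromiseProblem) (r : ℕ → ℕ) : Prop :=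
  ∀ m, ∃ n, m ≤ n ∧ ∀ x : Str, n ≤ x.length → x.length ≤ r n → B.val x = A.val x

theorem AgreesOnGaps.mono {A B : PromiseProblem} {r r' : ℕ → ℕ} (h : AgreesOnGaps A B r')
    (hr : ∀ n, r n ≤ r' n) : AgreesOnGaps A B r := fun m => by
  obtain ⟨n, hmn, hn⟩ := h m
  exact ⟨n, hmn, fun x hx hx' => hn x hx (hx'.trans (hr n))⟩

theorem exists_mem_length_ge {s : Set Str} (hs : s.Infinite) (n : ℕ) : ∃ x ∈ s, n ≤ x.length := by
  obtain ⟨x, hx, hn⟩ := (hs.sdiff (List.finite_length_lt Bool n)).nonempty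
  exact ⟨x, hx, not_lt.1 hn⟩

/-- If every problem decided by a computable series of total programs differs from `A` on infinitely
many strings in `w`, then for some computable `r`, every problem that agrees with `A` on the gaps
given by `r` inherits from `A` a difference in `w` to each of these problems. -/
theorem exists_gap_bound {M : ℕ → Nat.Partrec.Code} (hM : Computable M)
    (hh : ∀ i x, HaltsOn (M i) x) {A : PromiseProblem} (hA : Computable A.val) {w : Str → Bool}
    (hw : Computable w) (h : ∀ i B, TotallyDecides (M i) B →
      {x | w x = true ∧ A.val x ≠ B.val x}.Infinite) :
    ∃ r : ℕ → ℕ, Computable r ∧ ∀ B, AgreesOnGaps A B r → ∀ i B', TotallyDecides (M i) B' →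
      ∃ x, w x = true ∧ B.val x = A.val x ∧ B'.val x ≠ A.val x := by
  obtain ⟨e, he, hMe⟩ := exists_answers hM hh
  have hval : ∀ i B, TotallyDecides (M i) B → ∀ x, e i x = Encodable.encode (B.val x) :=
    fun i B hB x => Part.mem_unique (hMe i x) (totallyDecides_iff.1 hB x)
  obtain ⟨r, hr, hre⟩ := exists_disagreement_bound he (Computable.encode.comp hA) hw
    fun i hi n => by
      obtain ⟨B, hB⟩ := exists_totallyDecides (hMe i) hi
      obtain ⟨x, ⟨hwx, hx⟩, hn⟩ := exists_mem_length_ge (h i B hB) n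
      refine ⟨x, hn, hwx, fun hex => hx ?_⟩
      rw [hval i B hB] at hex
      exact (Encodable.encode_injective hex).symm
  refine ⟨r, hr, fun B hBA i B' hB' => ?_⟩
  obtain ⟨n, hin, hn⟩ := hBA i
  obtain ⟨x, h1, h2, h3, h4⟩ := hre n i hin fun x => by
    rw [hval i B' hB']
    rcases B'.val_cases x with h | h | h <;> simp [IsAnswerCode, h]
  refine ⟨x, h3, hn x h1 h2, fun hx => h4 ?_⟩
  rw [hval i B' hB', hx]

/-- For `A ∉ C` there is a computable `r` such that all problems that agree with `A` on the gaps
given by `r` are outside `C`, too.  The only exception is a class `C` of decision problems and an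
`A` that is none: then `A` may be a finite variation of a member of `C`, but no problem that is not
a decision problem belongs to `C`. -/
theorem exists_gap_bound_of_notMem {C : ComplexityClass} (hC : ClosedUnderFiniteVariations C)
    (hrC : RecursivelyPresentable C ∨ RecursivelyRepresentable C) {A : PromiseProblem}
    (hAC : A ∉ C) (hA : Computable A.val) :
    (∃ r : ℕ → ℕ, Computable r ∧ ∀ B, AgreesOnGaps A B r → B ∉ C) ∨
      (¬ A.IsDecision ∧ ∀ B ∈ C, B.IsDecision) := by
  by_cases hbad : ¬ A.IsDecision ∧ ∀ B ∈ C, B.IsDecision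
  · exact .inr hbad
  left
  -- a presentable class: the set `w` of `exists_gap_bound` consists of all strings; a representable
  -- one: of the promised strings of `A`, since `A` has to differ from all extensions
  rcases hrC with ⟨M, hM, hh, hMC⟩ | ⟨C₀, ⟨M, hM, hh, hMC⟩, rfl⟩
  · have hinf : ∀ B ∈ C, (B.totalSymmDiff A).Infinite := by
      intro B hB hfin
      rcases hC with hC | ⟨hdec, hC⟩
      · exact hAC (hC B hB A hfin)
      · exact hAC (hC B hB A (by_contra fun h => hbad ⟨h, hdec⟩) hfin)
    obtain ⟨r, hr, hrB⟩ := exists_gap_bound hM hh hA (w := fun _ => true) (Computable.const true)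
      fun i B hB => (hinf B ((hMC B).2 ⟨i, hB⟩)).mono fun x hx => ⟨rfl, by
        rcases hx with hx | hx
        · exact (PromiseProblem.val_ne_of_mem_diff hx).2.symm
        · exact (PromiseProblem.val_ne_of_mem_diff hx).2⟩
    refine ⟨r, hr, fun B hBA hB => ?_⟩
    obtain ⟨i, hi⟩ := (hMC B).1 hB
    obtain ⟨x, -, h1, h2⟩ := hrB B hBA i B hi
    exact h2 h1
  · have hinf : ∀ B ∈ C₀, (A.diff B).Infinite := by
      intro B hB hfin
      rcases hC with hC | ⟨hdec, -⟩
      · -- the restriction of `A` to the strings on which `B` agrees is a finite variation of `A`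
        let A₀ : PromiseProblem := ⟨A.yes ∩ B.yes, A.no ∩ B.no, by
          rw [Set.inter_inter_inter_comm, A.disj, Set.empty_inter]⟩
        refine hAC (hC A₀ ⟨B, hB, Set.inter_subset_right, Set.inter_subset_right⟩ A ?_)
        refine hfin.subset ?_
        rintro x ((⟨h1, h2⟩ | ⟨h1, h2⟩) | (⟨h1, h2⟩ | ⟨h1, h2⟩))
        · exact absurd h1.1 h2
        · exact absurd h1.1 h2
        · exact .inl ⟨h1, fun h => h2 ⟨h1, h⟩⟩
        · exact .inr ⟨h1, fun h => h2 ⟨h1, h⟩⟩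
      · -- a nonempty class that is closed under restrictions has the problem without promise
        have := hdec ⟨∅, ∅, Set.empty_inter _⟩ ⟨B, hB, Set.empty_subset _, Set.empty_subset _⟩
        simpa [PromiseProblem.promise] using Set.eq_univ_iff_forall.1 this []
    have hw : Computable fun x => !decide (A.val x = [true, false]) :=
      Primrec.not.to_comp.comp (Primrec.eq.decide.to_comp.comp hA (Computable.const _))
    obtain ⟨r, hr, hrB⟩ := exists_gap_bound hM hh hA hw
      fun i B hB => (hinf B ((hMC B).2 ⟨i, hB⟩)).mono fun x hx => by
        simpa using PromiseProblem.val_ne_of_mem_diff hx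
    refine ⟨r, hr, fun B hBA => ?_⟩
    rintro ⟨B', hB', hsub⟩
    obtain ⟨i, hi⟩ := (hMC B').1 hB'
    obtain ⟨x, h0, h1, h2⟩ := hrB B hBA i B' hi
    refine h2 ((hsub.val_eq ?_).trans h1)
    rw [h1]
    simpa using h0

/-! ### The diagonal problem -/

/-- The problem that coincides with `A (D.out n)` on the strings of length `n`. -/
def selectProblem (D : CounterMachine) (A : Bool → PromiseProblem) : PromiseProblem where
  yes := {x | x ∈ (A (D.out x.length)).yes}
  no := {x | x ∈ (A (D.out x.length)).no}
  disj := by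
    ext x
    simp only [Set.mem_inter_iff, Set.mem_empty_iff_false, iff_false, not_and]
    exact (A _).notMem_no_of_mem_yes

section SelectProblem

variable (D : CounterMachine) (A : Bool → PromiseProblem)

theorem selectProblem_val (x : Str) :
    (selectProblem D A).val x = (A (D.out x.length)).val x := rfl

theorem totallyDecidable_selectProblem (hA : ∀ b, TotallyDecidable (A b)) :
    TotallyDecidable (selectProblem D A) := by
  simp only [totallyDecidable_iff] at hA ⊢
  refine (Computable.cond (D.computable_out.comp Computable.list_length) (hA true)
    (hA false)).of_eq fun x => ?_
  rw [selectProblem_val]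
  cases D.out x.length <;> rfl

theorem karpReducible_selectProblem :
    KarpReducible (selectProblem D A) ((A false).markedUnion (A true)) := by
  refine ⟨fun x => D.out x.length :: x,
    PolyTimeComputable.select polyTimeComputable_cons D, fun x hx => ?_, fun x hx => ?_⟩
  · have hx' : x ∈ (A (D.out x.length)).yes := hx
    dsimp only
    generalize D.out x.length = b at hx' ⊢
    cases b
    · exact .inl ⟨x, hx', rfl⟩
    · exact .inr ⟨x, hx', rfl⟩
  · have hx' : x ∈ (A (D.out x.length)).no := hx
    dsimp only
    generalize D.out x.length = b at hx' ⊢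
    cases b
    · exact .inl ⟨x, hx', rfl⟩
    · exact .inr ⟨x, hx', rfl⟩

/-- Extremality can be checked string by string. -/
theorem isExtremalProblem_iff {V : Behaviour} {A : PromiseProblem} : V.IsExtremalProblem A ↔
    ∀ x, (x ∈ A.yes ↔ ∃ v ∈ V x, 2 / 3 ≤ v) ∧ (x ∈ A.no ↔ ∀ v ∈ V x, v ≤ 1 / 3) := by
  constructor
  · rintro ⟨⟨h1, h2⟩, h3⟩ x
    refine ⟨⟨h1 x, fun hx => ?_⟩, ⟨h2 x, fun hx => ?_⟩⟩
    · refine (h3 ⟨{x}, ∅, Set.inter_empty _⟩ ⟨?_, ?_⟩).1 rfl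
      · rintro _ rfl; exact hx
      · rintro _ ⟨⟩
    · refine (h3 ⟨∅, {x}, Set.empty_inter _⟩ ⟨?_, ?_⟩).2 rfl
      · rintro _ ⟨⟩
      · rintro _ rfl; exact hx
  · exact fun h => ⟨⟨fun x => (h x).1.1, fun x => (h x).2.1⟩,
      fun E hE => ⟨fun x hx => (h x).1.2 (hE.1 x hx), fun x hx => (h x).2.2 (hE.2 x hx)⟩⟩

theorem isExtremalFor_selectProblem {B : BaseClass} (hA : ∀ b, IsExtremalFor B (A b)) :
    IsExtremalFor B (selectProblem D A) := by
  choose V hV hVA using hA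
  refine ⟨fun x => V (D.out x.length) x, B.select_mem_behaviours hV D,
    isExtremalProblem_iff.2 fun x => isExtremalProblem_iff.1 (hVA _) x⟩

theorem isDecision_selectProblem (hA : ∀ b, (A b).IsDecision) :
    (selectProblem D A).IsDecision :=
  PromiseProblem.isDecision_iff.2 fun x => PromiseProblem.isDecision_iff.1 (hA _) x

end SelectProblem

/-- For computable `r`, a selected problem agrees with both given problems on the gaps given by
`r`, and it agrees with one of them, at choice, on the strings up to a given length. -/
theorem exists_selectProblem_agreesOnGaps (A : Bool → PromiseProblem) {r : ℕ → ℕ}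
    (hr : Computable r) (b₀ : Bool) (l : ℕ) : ∃ D : CounterMachine,
      (∀ b, AgreesOnGaps (A b) (selectProblem D A) r) ∧
      ∀ x : Str, x.length ≤ l → (selectProblem D A).val x = (A b₀).val x := by
  obtain ⟨D, h1, h2⟩ := CounterMachine.exists_out_gaps
    (Primrec.nat_add.to_comp.comp hr (Computable.const l)) b₀
  refine ⟨D, fun b m => ?_, fun x hx => ?_⟩
  · obtain ⟨n, hmn, hn⟩ := h2 b m
    refine ⟨n, hmn, fun x hx hx' => ?_⟩
    rw [selectProblem_val, hn _ hx (hx'.trans (Nat.le_add_right _ _))]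
  · rw [selectProblem_val, h1 _ (hx.trans (Nat.le_add_left _ _))]

/-- Some selected problem avoids both classes: it disagrees with every member of `C b` on a gap on
which it agrees with `A b`, or it fails to be a decision problem. -/
theorem exists_selectProblem_notMem {C : Bool → ComplexityClass} {A : Bool → PromiseProblem}
    (h : ∀ b, (∃ r : ℕ → ℕ, Computable r ∧ ∀ B, AgreesOnGaps (A b) B r → B ∉ C b) ∨
      (¬ (A b).IsDecision ∧ ∀ B ∈ C b, B.IsDecision)) :
    ∃ D : CounterMachine, ∀ b, selectProblem D A ∉ C b := by
  have hr : ∀ b, ∃ r : ℕ → ℕ, Computable r ∧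
      ((∀ B, AgreesOnGaps (A b) B r → B ∉ C b) ∨
        (¬ (A b).IsDecision ∧ ∀ B ∈ C b, B.IsDecision)) := by
    intro b
    rcases h b with ⟨r, hr, hrB⟩ | hb
    · exact ⟨r, hr, .inl hrB⟩
    · exact ⟨fun _ => 0, Computable.const 0, .inr hb⟩
  choose r hr hrB using hr
  -- if one of the classes consists of decision problems, agree with its problem on short strings
  obtain ⟨b₀, l, hl⟩ : ∃ (b₀ : Bool) (l : ℕ), ∀ D : CounterMachine,
      (∀ x : Str, x.length ≤ l → (selectProblem D A).val x = (A b₀).val x) →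
      (∃ b, ¬ (A b).IsDecision ∧ ∀ B ∈ C b, B.IsDecision) → ¬ (selectProblem D A).IsDecision := by
    by_cases hb : ∃ b, ¬ (A b).IsDecision ∧ ∀ B ∈ C b, B.IsDecision
    · obtain ⟨b, hb, -⟩ := hb
      simp only [PromiseProblem.isDecision_iff, not_forall, not_not] at hb
      obtain ⟨x, hx⟩ := hb
      refine ⟨b, x.length, fun D hD _ hdec => ?_⟩
      exact PromiseProblem.isDecision_iff.1 hdec x ((hD x le_rfl).trans hx)
    · exact ⟨true, 0, fun _ _ h => absurd h hb⟩
  obtain ⟨D, hD, hD₀⟩ := exists_selectProblem_agreesOnGaps A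
    (Primrec.nat_add.to_comp.comp (hr false) (hr true)) b₀ l
  refine ⟨D, fun b => ?_⟩
  rcases hrB b with h1 | h1
  · refine h1 _ ((hD b).mono fun n => ?_)
    cases b
    · exact Nat.le_add_right _ _
    · exact Nat.le_add_left _ _
  · exact fun hmem => hl D hD₀ ⟨b, h1⟩ (h1.2 _ hmem)

end UDT

theorem mainTheorem1 (C C' : UDT.ComplexityClass)
    (hC : UDT.ClosedUnderFiniteVariations C) (hC' : UDT.ClosedUnderFiniteVariations C')
    (hrC : UDT.RecursivelyPresentable C ∨ UDT.RecursivelyRepresentable C)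
    (hrC' : UDT.RecursivelyPresentable C' ∨ UDT.RecursivelyRepresentable C')
    (A A' : UDT.PromiseProblem) (hAC : A ∉ C) (hAC' : A' ∉ C')
    (hA : UDT.TotallyDecidable A) (hA' : UDT.TotallyDecidable A') :
    ∃ B : UDT.PromiseProblem,
      UDT.TotallyDecidable B ∧ B ∉ C ∪ C' ∧ UDT.KarpReducible B (A.markedUnion A') ∧
      (∀ D : UDT.BaseClass,
        UDT.IsExtremalFor D A → UDT.IsExtremalFor D A' → UDT.IsExtremalFor D B) ∧
      (A.IsDecision → A'.IsDecision → B.IsDecision) := by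
  let P : Bool → UDT.PromiseProblem := fun b => cond b A' A
  obtain ⟨D, hD⟩ := UDT.exists_selectProblem_notMem (C := fun b => cond b C' C) (A := P)
    (Bool.rec (UDT.exists_gap_bound_of_notMem hC hrC hAC (UDT.totallyDecidable_iff.1 hA))
      (UDT.exists_gap_bound_of_notMem hC' hrC' hAC' (UDT.totallyDecidable_iff.1 hA')))
  refine ⟨UDT.selectProblem D P, ?_, ?_, UDT.karpReducible_selectProblem D P, ?_, ?_⟩
  · exact UDT.totallyDecidable_selectProblem D P (Bool.rec hA hA')
  · rintro (h | h)
    · exact hD false h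
    · exact hD true h
  · exact fun B h h' => UDT.isExtremalFor_selectProblem D P (Bool.rec h h')
  · exact fun h h' => UDT.isDecision_selectProblem D P (Bool.rec h h')
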